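/- **Conventions.** Let $\mathtt{Ass}=\Delta^{\mathrm{op}}$ be the opposite of the category of finite non-empty ordinals $[n]=\{0<\dots<n\}$, and let $\Delta_{\mathtt{Ass}}$ be its category of simplices: objects are functors $\sigma:[k]\to\mathtt{Ass}$ with $k\ge 0$, morphisms are monotone maps over $\mathtt{Ass}$. Write $\sigma_a=[n_a]$ for the vertices of $\sigma$ and $\alpha_{ab}:\sigma_b\to\sigma_a$ $(a\le b)$ for the monotone maps underlying its edges. The edges of $[n]$ are $e=0,\dots,n-1$; the edge $e$ joins $e$ to $e+1$. $\mathbf{Cat}^{\le 1}$ is the $(2,1)$-category of classical categories, functors and natural isomorphisms. **Hinich's functor $\mathcal F:\Delta_{\mathtt{Ass}}\to\mathbf{Cat}^{\le1}$.** The objects of $\mathcal F(\sigma)$ are the symbols $\mathbf x_e,\mathbf y_e$ in level $a$, for each vertex $a$ of $[k]$ and each edge $e$ of $\sigma_a$. For $a\le b$, an edge $j$ of $\sigma_b$, and a vertex $i$ of $\sigma_a$ with $\alpha_{ab}(j)\le i\le\alpha_{ab}(j+1)$ there is an arrow $p_{j,i}\to q_{j,i}$, where $p_{j,i}$ is $\mathbf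 x_j$ in level $b$ if $i=\alpha_{ab}(j)$ and $\mathbf y_{i-1}$ in level $a$ otherwise, and $q_{j,i}$ is $\mathbf y_j$ in level $b$ if $i=\alpha_{ab}(j+1)$ and $\mathbf x_i$ in level $a$ otherwise. $\mathcal F(\sigma)$ is the ordered set generated by these arrows for $b=a+1$. It then contains the arrows for all $a\le b$, and a morphism $f:\sigma\to\tau$ acts by sending $\mathbf x_e,\mathbf y_e$ in level $a$ to $\mathbf x_e,\mathbf y_e$ in level $f(a)$. **Gepner–Haugseng's operad $\mathcal O_X$.** For a category $X$, $\mathcal O_X$ is the category of operators, over $\mathtt{Ass}$, of the multicategory with objects $\mathrm{Ob}X\times\mathrm{Ob}X$ and $$\mathcal O_X\big((u_1^{\mathbf x},u_1^{\mathbf y}),\dots,(u_n^{\mathbf x},u_n^{\mathbf y});(v^{\mathbf x},v^{\mathbf y})\big)=X(v^{\mathbf x},u_1^{\mathbf x})\times\prod_{i=2}^{n}X(u_{i-1}^{\mathbf y},u_i^{\mathbf x})\times X(u_n^{\mathbf y},v^{\mathbf y})$$ (for $n=0$: $X(v^{\mathbf x},v^{\mathbf y})$), with composition induced by composition in $X$.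 So its objects over $[n]$ are $n$-tuples of pairs of objects of $X$, and a morphism $u\to v$ over $\alpha:[m]\to[n]$ is a family of multimorphisms $(u_e)_{\alpha(j)\le e<\alpha(j+1)}\to v_j$, one for each edge $j$ of $[m]$. A functor $X\to Y$ induces a functor $\mathcal O_X\to\mathcal O_Y$ over $\mathtt{Ass}$; a natural isomorphism of functors $X\to Y$ induces one over $\mathtt{Ass}$. **Proposition.** There is a formal adjunction $\mathcal F\dashv\mathcal O$ between $\mathcal F:\Delta_{\mathtt{Ass}}\to\mathbf{Cat}^{\le1}$ and $\mathcal O:\mathbf{Cat}^{\le1}\to\mathbf{Cat}^{\le1}_{\mathtt{Ass}}$. That is, there are isomorphisms of groupoids $$\mathrm{adj}_{\sigma,X}:\ \mathrm{Fun}_{\mathtt{Ass}}(\sigma,\mathcal O_X)\;\cong\;\mathrm{Fun}(\mathcal F(\sigma),X)$$ (in particular bijections on objects) between the groupoid of functors $[k]\to\mathcal O_X$ over $\mathtt{Ass}$ with their isomorphisms over $\mathtt{Ass}$, and the groupoid of functors $\mathcal F(\sigma)\to X$ with their natural isomorphisms; they are natural in $\sigma\in\Delta_{\mathtt{Ass}}$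 (for all morphisms: face maps, including inner ones, and degeneracies) and in $X\in\mathbf{Cat}^{\le1}$ (for functors and for natural isomorphisms between them). Moreover $\mathrm{adj}$ can be chosen to be the explicit labelling of Hinich's diagrams by the variables of Gepner–Haugseng. For $H\in\mathrm{Fun}_{\mathtt{Ass}}(\sigma,\mathcal O_X)$ with $H(a)=u$, the functor $\mathrm{adj}(H)$ takes $\mathbf x_e,\mathbf y_e$ in level $a$ to $u_e^{\mathbf x},u_e^{\mathbf y}$. It takes the arrow $p_{j,i}\to q_{j,i}$ of the edge $\sigma_a\to\sigma_b$ to the member with index $i$, $\alpha_{ab}(j)\le i\le\alpha_{ab}(j+1)$, of the family of morphisms of $X$ that constitutes the $j$-th multimorphism of $H(a)\to H(b)$. For an isomorphism $\varepsilon:H\cong K$ over $\mathtt{Ass}$, whose $e$-th multimorphism at $a$ is a pair $(f,g)\in X(K(a)_e^{\mathbf x},H(a)_e^{\mathbf x})\times X(H(a)_e^{\mathbf y},K(a)_e^{\mathbf y})$, the isomorphism $\mathrm{adj}(\varepsilon)$ has the component $f^{-1}$ at $\mathbf x_e$ and $g$ at $\mathbf y_e$ in level $a$. -/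

import Mathlib

open CategoryTheory Opposite

universe v u

/-! ## Functors over a base -/

/-- A functor `A ⥤ E` over `B`, where `A` and `E` live over `B` through `σ` and `π`. -/
structure FunOver {A B E : Type*} [Category A] [Category B] [Category E]
    (σ : A ⥤ B) (π : E ⥤ B) where
  functor : A ⥤ E
  w : functor ⋙ π = σ

namespace FunOver

section

variable {A B E A' E' : Type*} [Category A] [Category B] [Category E] [Category A'] [Category E']

/-- The groupoid `Fun_B(A, E)` of functors over `B`; its morphisms are the natural isomorphisms
that lie over the identity. -/
instance groupoid (σ : A ⥤ B) (π : E ⥤ B) : Groupoid (FunOver σ π) where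
  Hom H K := {e : H.functor ≅ K.functor //
    Functor.isoWhiskerRight e π = eqToIso (H.w.trans K.w.symm)}
  id H := ⟨Iso.refl _, by simp⟩
  comp e f := ⟨e.1 ≪≫ f.1, by
    rw [Functor.isoWhiskerRight_trans, e.2, f.2, eqToIso_trans]⟩
  inv e := ⟨e.1.symm, by
    have h : Functor.isoWhiskerRight e.1.symm π = (Functor.isoWhiskerRight e.1 π).symm := rfl
    rw [h, e.2]; rfl⟩
  id_comp e := Subtype.ext (Iso.refl_trans _)
  comp_id e := Subtype.ext (Iso.trans_refl _)
  assoc e f g := Subtype.ext (Iso.trans_assoc _ _ _)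
  inv_comp e := Subtype.ext (Iso.symm_self_id _)
  comp_inv e := Subtype.ext (Iso.self_symm_id _)

/-- Precomposition with a functor over `B`. -/
def precomp {σ : A ⥤ B} {τ : A' ⥤ B} (f : A' ⥤ A) (hf : f ⋙ σ = τ) (π : E ⥤ B) :
    FunOver σ π ⥤ FunOver τ π where
  obj H := ⟨f ⋙ H.functor, by rw [Functor.assoc, H.w, hf]⟩
  map {H K} e := ⟨Functor.isoWhiskerLeft f e.1, by
    ext a
    have h := congrArg (fun i => i.hom.app (f.obj a)) e.2
    simp only [eqToIso.hom, eqToHom_app] at h ⊢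
    exact h⟩
  map_id _ := rfl
  map_comp _ _ := rfl

/-- Postcomposition with a functor over `B`. -/
def postcomp (σ : A ⥤ B) {π : E ⥤ B} {π' : E' ⥤ B} (G : E ⥤ E') (hG : G ⋙ π' = π) :
    FunOver σ π ⥤ FunOver σ π' where
  obj H := ⟨H.functor ⋙ G, by rw [Functor.assoc, hG, H.w]⟩
  map {H K} e := ⟨Functor.isoWhiskerRight e.1 G, by
    subst hG
    ext a
    have h := congrArg (fun i => i.hom.app a) e.2
    simp only [eqToIso.hom, eqToHom_app] at h ⊢
    exact h⟩
  map_id H := Subtype.ext (by simp [CategoryStruct.id])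
  map_comp e f := Subtype.ext (by simp [CategoryStruct.comp])

/-- A natural isomorphism over `B` between two functors `G` and `G'` over `B` induces a morphism
between the postcompositions with `G` and with `G'`. -/
def postcompIso {σ : A ⥤ B} {π : E ⥤ B} {π' : E' ⥤ B} {G G' : E ⥤ E'} (hG : G ⋙ π' = π)
    (hG' : G' ⋙ π' = π) (α : G ≅ G')
    (hα : Functor.isoWhiskerRight α π' = eqToIso (hG.trans hG'.symm)) (H : FunOver σ π) :
    (postcomp σ G hG).obj H ⟶ (postcomp σ G' hG').obj H :=
  ⟨Functor.isoWhiskerLeft H.functor α, by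
    ext a
    have h := congrArg (fun i => i.hom.app (H.functor.obj a)) hα
    simp only [eqToIso.hom, eqToHom_app] at h ⊢
    exact h⟩

end

end FunOver

/-! ## The category of simplices of `Ass = Δᵒᵖ` -/

/-- A simplex of `Ass = Δᵒᵖ`: a functor `σ : {0 < ⋯ < k} ⥤ Δᵒᵖ`. -/
structure AssSimplex where
  dim : ℕ
  functor : Fin (dim + 1) ⥤ SimplexCategoryᵒᵖ

namespace AssSimplex

/-- The `a`-th vertex of `σ`. -/
def vertex (σ : AssSimplex) (a : Fin (σ.dim + 1)) : SimplexCategory := (σ.functor.obj a).unop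

/-- The edge `σ_a ⟶ σ_b` of `σ` in `Ass`, as a monotone map of vertex sets in the opposite
direction. -/
def arrow (σ : AssSimplex) {a b : Fin (σ.dim + 1)} (h : a ≤ b) :
    Fin ((σ.vertex b).len + 1) →o Fin ((σ.vertex a).len + 1) :=
  (σ.functor.map (homOfLE h)).unop.toOrderHom

/-- A morphism of simplices of `Ass`: a monotone map over `Ass`. -/
@[ext]
structure Hom (σ τ : AssSimplex) where
  toOrderHom : Fin (σ.dim + 1) →o Fin (τ.dim + 1)
  w : toOrderHom.monotone.functor ⋙ τ.functor = σ.functor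

/-- The category `Δ_Ass` of simplices of `Ass`. -/
instance : Category AssSimplex where
  Hom := Hom
  id σ := ⟨OrderHom.id, rfl⟩
  comp {σ τ ρ} f g := ⟨g.toOrderHom.comp f.toOrderHom, by
    rw [← f.w, ← g.w]; rfl⟩

@[simp] lemma id_toOrderHom (σ : AssSimplex) : Hom.toOrderHom (𝟙 σ) = OrderHom.id := rfl

@[simp] lemma comp_toOrderHom {σ τ ρ : AssSimplex} (f : σ ⟶ τ) (g : τ ⟶ ρ) :
    Hom.toOrderHom (f ≫ g) = (Hom.toOrderHom g).comp (Hom.toOrderHom f) := rfl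

lemma Hom.vertex_eq {σ τ : AssSimplex} (f : σ ⟶ τ) (a : Fin (σ.dim + 1)) :
    σ.vertex a = τ.vertex (f.toOrderHom a) :=
  congrArg unop (Functor.congr_obj f.w a).symm

lemma Hom.len_eq {σ τ : AssSimplex} (f : σ ⟶ τ) (a : Fin (σ.dim + 1)) :
    (σ.vertex a).len = (τ.vertex (f.toOrderHom a)).len :=
  congrArg SimplexCategory.len (f.vertex_eq a)

lemma arrow_rfl (σ : AssSimplex) (a : Fin (σ.dim + 1)) (i) : σ.arrow (le_refl a) i = i := by
  have h : σ.functor.map (homOfLE (le_refl a)) = 𝟙 _ := σ.functor.map_id a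
  unfold arrow
  rw [h]
  rfl

lemma arrow_trans (σ : AssSimplex) {a b c : Fin (σ.dim + 1)} (h : a ≤ b) (h' : b ≤ c) (i) :
    σ.arrow (h.trans h') i = σ.arrow h (σ.arrow h' i) := by
  have := σ.functor.map_comp (homOfLE h) (homOfLE h')
  unfold arrow
  rw [← homOfLE_comp h h', this]
  rfl

lemma Hom.arrow_val {σ τ : AssSimplex} (f : σ ⟶ τ) {a b : Fin (σ.dim + 1)} (h : a ≤ b)
    (i : Fin ((σ.vertex b).len + 1)) :
    (σ.arrow h i : ℕ) = τ.arrow (f.toOrderHom.monotone h)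
      (Fin.cast (congrArg (· + 1) (f.len_eq b)) i) := by
  obtain ⟨k, S⟩ := σ
  obtain ⟨f, w⟩ := f
  change Fin (k + 1) →o Fin (τ.dim + 1) at f
  change f.monotone.functor ⋙ τ.functor = S at w
  subst w
  rfl

/-! ## Hinich's functor -/

/-- The two kinds of objects of Hinich's diagrams. -/
inductive Side
  | x
  | y

/-- The set `F₀(σ) = ∐_a {edges of σ_a} × {x, y}` of objects of `F(σ)`. The edge `e` of `σ_a` has
the vertices `e.castSucc` and `e.succ`. -/
@[ext]
structure F₀ (σ : AssSimplex) where
  level : Fin (σ.dim + 1)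
  edge : Fin (σ.vertex level).len
  side : Side

/-- Let `a ≤ b`, let `α : σ_b → σ_a` be the underlying monotone map, let `j` be an edge of `σ_b`,
and let `I = {α(j), …, α(j + 1)}` be the corresponding interval of vertices of `σ_a`. For each
vertex `i ∈ I` there is one arrow; its source is `x_j` in level `b` when `i` is the
first element of `I`, and otherwise is `y_e` in level `a`, where `e` is the edge that ends in `i`. -/
inductive ArrowSource (σ : AssSimplex) {a b : Fin (σ.dim + 1)} (h : a ≤ b)
    (j : Fin (σ.vertex b).len) : Fin ((σ.vertex a).len + 1) → F₀ σ → Prop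
  | first : ArrowSource σ h j (σ.arrow h j.castSucc) ⟨b, j, .x⟩
  | inner (e : Fin (σ.vertex a).len) (hl : σ.arrow h j.castSucc ≤ e.castSucc)
      (hr : e.succ ≤ σ.arrow h j.succ) : ArrowSource σ h j e.succ ⟨a, e, .y⟩

/-- The target of the arrow at the vertex `i ∈ I` is `y_j` in level `b` when `i` is
the last element of `I`, and otherwise is `x_e` in level `a`, where `e` is the edge that starts
in `i`. -/
inductive ArrowTarget (σ : AssSimplex) {a b : Fin (σ.dim + 1)} (h : a ≤ b)
    (j : Fin (σ.vertex b).len) : Fin ((σ.vertex a).len + 1) → F₀ σ → Prop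
  | last : ArrowTarget σ h j (σ.arrow h j.succ) ⟨b, j, .y⟩
  | inner (e : Fin (σ.vertex a).len) (hl : σ.arrow h j.castSucc ≤ e.castSucc)
      (hr : e.succ ≤ σ.arrow h j.succ) : ArrowTarget σ h j e.castSucc ⟨a, e, .x⟩

/-- `p → q` is the arrow at the vertex `i` of Hinich's diagram for the edge `σ_a ⟶ σ_b` of `σ`, in
the component that belongs to the edge `j` of `σ_b`. -/
def IsArrow (σ : AssSimplex) {a b : Fin (σ.dim + 1)} (h : a ≤ b)
    (j : Fin (σ.vertex b).len) (i : Fin ((σ.vertex a).len + 1)) (p q : F₀ σ) : Prop :=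
  ArrowSource σ h j i p ∧ ArrowTarget σ h j i q

/-- The arrows of the oriented graph `F^Grf(σ)`, which is the union of the diagrams of the edges
`σ_a ⟶ σ_{a+1}`. -/
def GraphArrow (σ : AssSimplex) (p q : F₀ σ) : Prop :=
  ∃ (a b : Fin (σ.dim + 1)) (hab : (a : ℕ) + 1 = b) (j : Fin (σ.vertex b).len)
    (i : Fin ((σ.vertex a).len + 1)),
    σ.IsArrow (Fin.le_def.2 (by omega) : a ≤ b) j i p q

/-- `F(σ)` as an ordered set: `p ≤ q` if there is a path from `p` to `q` in `F^Grf(σ)`.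
This graph is a disjoint union of linear chains, so its free category is this ordered set. -/
instance (σ : AssSimplex) : Preorder (F₀ σ) where
  le := Relation.ReflTransGen σ.GraphArrow
  le_refl _ := Relation.ReflTransGen.refl
  le_trans _ _ _ := Relation.ReflTransGen.trans

lemma GraphArrow.le {σ : AssSimplex} {p q : F₀ σ} (h : σ.GraphArrow p q) : p ≤ q :=
  Relation.ReflTransGen.single h

section InnerFaces

variable {σ : AssSimplex} {a b c : Fin (σ.dim + 1)}

lemma exists_arrowTarget (h : a ≤ b) (j : Fin (σ.vertex b).len)
    (i : Fin ((σ.vertex a).len + 1)) (hl : σ.arrow h j.castSucc ≤ i)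
    (hr : i ≤ σ.arrow h j.succ) : ∃ q, ArrowTarget σ h j i q := by
  rcases hr.lt_or_eq with hlt | rfl
  · exact ⟨_, ArrowTarget.inner ⟨i, by have := (σ.arrow h j.succ).2; omega⟩ hl hlt⟩
  · exact ⟨_, ArrowTarget.last⟩

/-- Beginning with the target at the vertex `i` of `σ_b`, one reaches the target of the composite
diagram at the image of `i` in `σ_a`. -/
lemma target_le_target (h : a ≤ b) (h' : b ≤ c)
    (H : ∀ j i p q, σ.IsArrow h j i p q → p ≤ q)
    (H' : ∀ j i p q, σ.IsArrow h' j i p q → p ≤ q)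
    (k : Fin (σ.vertex c).len) (d : ℕ) :
    ∀ (i : Fin ((σ.vertex b).len + 1)), (σ.arrow h' k.succ : ℕ) = i + d →
      σ.arrow h' k.castSucc ≤ i → ∀ q r, ArrowTarget σ h' k i q →
      ArrowTarget σ (h.trans h') k (σ.arrow h i) r → q ≤ r := by
  induction d with
  | zero =>
    intro i hi hl q r hq hr
    have hi' : i = σ.arrow h' k.succ := Fin.ext (by omega)
    have hq' : q = ⟨c, k, .y⟩ := by
      cases hq with
      | last => rfl
      | inner e hl' hr' => simp only [Fin.le_def, Fin.val_succ] at *; simp at hi; omega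
    have hr' : r = ⟨c, k, .y⟩ := by
      generalize hz : σ.arrow h i = z at hr
      cases hr with
      | last => rfl
      | inner e hl' hr' =>
        rw [arrow_trans σ h h', ← hi', hz] at hr'
        simp [Fin.le_def] at hr'
    rw [hq', hr']
  | succ d ih =>
    intro i hi hl q r hq hr
    cases hq with
    | last => omega
    | inner e hl' hr' =>
      have hstep := (σ.arrow h).monotone (Fin.castSucc_le_succ e)
      rcases hstep.lt_or_eq with hlt | heq
      · -- the interval of `e` in `σ_a` is not a point
        let e' : Fin (σ.vertex a).len := ⟨σ.arrow h e.castSucc,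
          by have := (σ.arrow h e.succ).2; simp only [Fin.lt_def] at hlt; omega⟩
        have hr2 : r = ⟨a, e', .x⟩ := by
          have hmono := (σ.arrow h).monotone hr'
          generalize hz : σ.arrow h e.castSucc = z at hr
          cases hr with
          | last =>
            rw [arrow_trans σ h h'] at hz
            rw [← hz] at hmono
            exact absurd hlt (not_lt.2 hmono)
          | inner e'' hl'' hr'' =>
            have : e' = e'' := Fin.ext (by simpa [e'] using congrArg Fin.val hz)
            rw [this]
        rw [hr2]
        apply H e (σ.arrow h e.castSucc)
        refine ⟨ArrowSource.first, ?_⟩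
        have := ArrowTarget.inner (h := h) (j := e) e' (le_of_eq (Fin.ext rfl))
          (by simp only [Fin.lt_def] at hlt; simp [Fin.le_def, e']; omega)
        exact this
      · -- the interval of `e` in `σ_a` is a point
        have h1 : (⟨b, e, .x⟩ : F₀ σ) ≤ ⟨b, e, .y⟩ := by
          apply H e (σ.arrow h e.castSucc)
          refine ⟨ArrowSource.first, ?_⟩
          rw [heq]
          exact ArrowTarget.last
        obtain ⟨q', hq'⟩ := exists_arrowTarget h' k e.succ
          (hl'.trans (Fin.castSucc_le_succ e)) hr'
        have h2 : (⟨b, e, .y⟩ : F₀ σ) ≤ q' := H' k e.succ _ _ ⟨ArrowSource.inner e hl' hr', hq'⟩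
        have h3 : q' ≤ r := by
          apply ih e.succ _ (hl'.trans (Fin.castSucc_le_succ e)) _ _ hq'
          · rw [← heq]; exact hr
          · simp at hi ⊢; omega
        exact (h1.trans h2).trans h3

/-- The arrows of the diagram of a composite are composites of arrows. -/
lemma isArrow_le_trans (h : a ≤ b) (h' : b ≤ c)
    (H : ∀ j i p q, σ.IsArrow h j i p q → p ≤ q)
    (H' : ∀ j i p q, σ.IsArrow h' j i p q → p ≤ q)
    (k : Fin (σ.vertex c).len) (i : Fin ((σ.vertex a).len + 1)) (p q : F₀ σ)
    (hpq : σ.IsArrow (h.trans h') k i p q) : p ≤ q := by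
  have hk : σ.arrow h' k.castSucc ≤ σ.arrow h' k.succ :=
    (σ.arrow h').monotone (Fin.castSucc_le_succ k)
  have key : ∀ (j : Fin ((σ.vertex b).len + 1)) (p' : F₀ σ), ArrowSource σ h' k j p' →
      σ.arrow h' k.castSucc ≤ j → j ≤ σ.arrow h' k.succ → i = σ.arrow h j → p' ≤ q := by
    intro j p' hp' hl hr hij
    obtain ⟨q', hq'⟩ := exists_arrowTarget h' k j hl hr
    refine (H' _ _ _ _ ⟨hp', hq'⟩).trans ?_
    refine target_le_target h h' H H' k ((σ.arrow h' k.succ : ℕ) - j) j ?_ hl _ _ hq' ?_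
    · simp only [Fin.le_def] at hr; omega
    · rw [← hij]; exact hpq.2
  obtain ⟨hp, hq⟩ := hpq
  cases hp with
  | first => exact key _ _ ArrowSource.first le_rfl hk (arrow_trans _ _ _ _)
  | inner e hl hr =>
    -- the first vertex of `σ_b` in the interval whose image is at or after `i = e.succ`
    have hex : ∃ n : ℕ, ∃ hn : n < (σ.vertex b).len + 1, e.succ ≤ σ.arrow h ⟨n, hn⟩ :=
      ⟨σ.arrow h' k.succ, (σ.arrow h' k.succ).2, by rw [arrow_trans σ h h'] at hr; exact hr⟩
    classical
    obtain ⟨hn, hle⟩ := Nat.find_spec hex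
    have hmin := fun m => Nat.find_min hex (m := m)
    have hup : Nat.find hex ≤ σ.arrow h' k.succ :=
      Nat.find_min' hex ⟨(σ.arrow h' k.succ).2, by rw [arrow_trans σ h h'] at hr; exact hr⟩
    generalize Nat.find hex = n at hn hle hmin hup
    have hlow : (σ.arrow h' k.castSucc : ℕ) < n := by
      by_contra hcon
      have h1 : σ.arrow h ⟨n, hn⟩ ≤ σ.arrow h (σ.arrow h' k.castSucc) :=
        (σ.arrow h).monotone (Fin.le_def.2 (by simpa using hcon))
      rw [← arrow_trans] at h1
      have := hle.trans (h1.trans hl)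
      simp [Fin.le_def] at this
    obtain ⟨m, rfl⟩ : ∃ m, n = m + 1 := ⟨n - 1, by omega⟩
    let j : Fin (σ.vertex b).len := ⟨m, by omega⟩
    have hm : σ.arrow h j.castSucc ≤ e.castSucc := by
      have : ¬ (e.succ ≤ σ.arrow h j.castSucc) := fun hcon =>
        hmin m (by omega) ⟨by omega, hcon⟩
      simp only [Fin.le_def, Fin.val_succ, Fin.val_castSucc] at this ⊢
      omega
    have hsrc : ArrowSource σ h j e.succ ⟨a, e, .y⟩ := ArrowSource.inner e hm hle
    rcases hle.lt_or_eq with hlt | heq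
    · refine H j e.succ _ _ ⟨hsrc, ?_⟩
      let e' : Fin (σ.vertex a).len := ⟨e + 1, by
        have := (σ.arrow h ⟨m + 1, hn⟩).2
        simp only [Fin.lt_def, Fin.val_succ] at hlt; omega⟩
      have he' : e.succ = e'.castSucc := Fin.ext rfl
      have hq' : q = ⟨a, e', .x⟩ := by
        generalize hz : e.succ = z at hq
        cases hq with
        | last =>
          rw [arrow_trans σ h h'] at hz
          have := (σ.arrow h).monotone (Fin.le_def.2 hup : ⟨m + 1, hn⟩ ≤ σ.arrow h' k.succ)
          rw [← hz] at this
          exact absurd hlt (not_lt.2 this)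
        | inner e'' hl'' hr'' =>
          have : e' = e'' := Fin.ext (by simpa [e'] using congrArg Fin.val hz)
          rw [this]
      rw [hq', he']
      refine ArrowTarget.inner e' (hm.trans ?_) ?_
      · simp [Fin.le_def, e']
      · simp only [Fin.lt_def, Fin.val_succ] at hlt
        simp only [Fin.le_def, Fin.val_succ, e']
        exact hlt
    · have h1 : (⟨a, e, .y⟩ : F₀ σ) ≤ ⟨b, j, .y⟩ := by
        refine H j e.succ _ _ ⟨hsrc, ?_⟩
        rw [heq]
        exact ArrowTarget.last
      refine h1.trans (key ⟨m + 1, hn⟩ _ ?_ (Fin.le_def.2 hlow.le) (Fin.le_def.2 hup) heq)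
      exact ArrowSource.inner j (Fin.le_def.2 (by simp [j]; omega)) (Fin.le_def.2 hup)

/-- The diagram of every edge `σ_a ⟶ σ_b` of `σ` maps to `F(σ)`. -/
lemma IsArrow.le {σ : AssSimplex} {a b : Fin (σ.dim + 1)} (h : a ≤ b)
    (j : Fin (σ.vertex b).len) (i : Fin ((σ.vertex a).len + 1)) (p q : F₀ σ)
    (hpq : σ.IsArrow h j i p q) : p ≤ q := by
  obtain ⟨d, hd⟩ : ∃ d : ℕ, (b : ℕ) = a + d := ⟨b - a, by rw [Fin.le_def] at h; omega⟩
  induction d generalizing b i p q with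
  | zero =>
    obtain rfl : a = b := Fin.ext (by omega)
    obtain ⟨hp, hq⟩ := hpq
    have : p = q := by
      generalize hz : i = z at hq
      cases hp with
      | first =>
        cases hq with
        | last =>
          rw [arrow_rfl, arrow_rfl] at hz
          simp [Fin.ext_iff] at hz
        | inner e hl hr =>
          rw [arrow_rfl] at hz
          obtain rfl : j = e := Fin.ext (by simpa [Fin.ext_iff] using hz)
          rfl
      | inner e hl hr =>
        simp only [arrow_rfl, Fin.le_def, Fin.val_succ, Fin.val_castSucc] at hl hr
        obtain rfl : j = e := Fin.ext (by omega)
        cases hq with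
        | last => rfl
        | inner e' hl' hr' =>
          simp only [arrow_rfl, Fin.le_def, Fin.val_succ, Fin.val_castSucc] at hl' hr'
          simp only [Fin.ext_iff, Fin.val_succ, Fin.val_castSucc] at hz
          omega
    rw [this]
  | succ d ih =>
    let c : Fin (σ.dim + 1) := ⟨a + d, by have := b.2; omega⟩
    have hac : a ≤ c := Fin.le_def.2 (by simp [c])
    have hcb : c ≤ b := Fin.le_def.2 (by simp [c]; omega)
    refine isArrow_le_trans hac hcb (fun j i p q hpq => ih hac j i p q hpq rfl) ?_ j i p q hpq
    intro j i p q hpq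
    exact GraphArrow.le ⟨c, b, by simp [c]; omega, j, i, hpq⟩

end InnerFaces

/-- The action of a morphism of simplices on the objects of Hinich's diagrams. -/
def F₀.map {σ τ : AssSimplex} (f : σ ⟶ τ) (p : F₀ σ) : F₀ τ :=
  ⟨f.toOrderHom p.level, Fin.cast (f.len_eq p.level) p.edge, p.side⟩

lemma F₀.map_monotone {σ τ : AssSimplex} (f : σ ⟶ τ) : Monotone (F₀.map f) := by
  intro p q hpq
  refine Relation.ReflTransGen.trans_induction_on (motive := fun {p q} _ => F₀.map f p ≤ F₀.map f q)
    hpq (fun _ => le_rfl) ?_ (fun _ _ h h' => h.trans h')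
  rintro p q ⟨a, b, hab, j, i, hp, hq⟩
  have hle : a ≤ b := Fin.le_def.2 (by omega)
  refine IsArrow.le (f.toOrderHom.monotone hle) (Fin.cast (f.len_eq b) j)
    (Fin.cast (congrArg (· + 1) (f.len_eq a)) i) _ _ ⟨?_, ?_⟩
  · cases hp with
    | first =>
      have hz : Fin.cast (congrArg (· + 1) (f.len_eq a)) (σ.arrow hle j.castSucc) =
          τ.arrow (f.toOrderHom.monotone hle) (Fin.cast (f.len_eq b) j).castSucc :=
        Fin.ext (f.arrow_val hle j.castSucc)
      rw [hz]
      exact ArrowSource.first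
    | inner e hl hr =>
      rw [Fin.le_def, f.arrow_val] at hl hr
      exact ArrowSource.inner (Fin.cast (f.len_eq a) e) hl hr
  · cases hq with
    | last =>
      have hz : Fin.cast (congrArg (· + 1) (f.len_eq a)) (σ.arrow hle j.succ) =
          τ.arrow (f.toOrderHom.monotone hle) (Fin.cast (f.len_eq b) j).succ :=
        Fin.ext (f.arrow_val hle j.succ)
      rw [hz]
      exact ArrowTarget.last
    | inner e hl hr =>
      rw [Fin.le_def, f.arrow_val] at hl hr
      exact ArrowTarget.inner (Fin.cast (f.len_eq a) e) hl hr

end AssSimplex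

/-- Hinich's functor `F : Δ_Ass ⥤ Cat`. Its values are ordered sets. -/
def hinichF : AssSimplex ⥤ Cat.{0, 0} where
  obj σ := Cat.of (AssSimplex.F₀ σ)
  map f := (AssSimplex.F₀.map_monotone f).functor.toCatHom
  map_id _ := rfl
  map_comp _ _ := rfl

/-! ## The operad of Gepner and Haugseng -/

/-- Let `u_0, …, u_{n-1}` be pairs of objects of `X`, where `u_e = (u_e.1, u_e.2)` is attached to the
edge `e` of `[n]`. An element of `Multi u i a k b` is a family of morphisms of `X`
`a ⟶ u_i.1`, `u_i.2 ⟶ u_{i+1}.1`, …, `u_{k-2}.2 ⟶ u_{k-1}.1`, `u_{k-1}.2 ⟶ b`,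
which for `i = k` means a single morphism `a ⟶ b`. Thus `Multi u i a k b` is the set
`O_X(u_i, …, u_{k-1}; (a, b)) = X(a, u_i.1) × ∏ X(u_{e-1}.2, u_e.1) × X(u_{k-1}.2, b)` of multimorphisms. -/
inductive Multi {X : Type u} [Category.{v} X] {n : ℕ} (u : Fin n → X × X) :
    Fin (n + 1) → X → Fin (n + 1) → X → Type (max u v)
  | nil {i : Fin (n + 1)} {a b : X} (f : a ⟶ b) : Multi u i a i b
  | cons {i : Fin n} {a : X} {k : Fin (n + 1)} {b : X} (f : a ⟶ (u i).1)
      (s : Multi u i.succ (u i).2 k b) : Multi u i.castSucc a k b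

namespace Multi

section

variable {X : Type u} [Category.{v} X] {n m l : ℕ} {u : Fin n → X × X} {t : Fin m → X × X}
  {w : Fin l → X × X}

/-- The family of morphisms that constitutes a multimorphism. -/
def arrows {i a k b} : Multi u i a k b → List (Arrow X)
  | nil f => [Arrow.mk f]
  | cons f s => Arrow.mk f :: s.arrows

/-- Composition of the first member of the family with a morphism of `X`. -/
def precomp {i a a' k b} (f : a' ⟶ a) : Multi u i a k b → Multi u i a' k b
  | nil g => nil (f ≫ g)
  | cons g s => cons (f ≫ g) s

/-- Concatenation of two families; the last member of the first family is composed with the first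
member of the second. -/
def append {i a j b k c} : Multi u i a j b → Multi u j b k c → Multi u i a k c
  | nil f, s => s.precomp f
  | cons f r, s => cons f (r.append s)

/-- Substitution of multimorphisms `f_0, …, f_{m-1}` into a multimorphism with inputs
`t_0, …, t_{m-1}`. -/
def subst {φ : Fin (m + 1) → Fin (n + 1)}
    (f : ∀ j : Fin m, Multi u (φ j.castSucc) (t j).1 (φ j.succ) (t j).2) {i a k b} :
    Multi t i a k b → Multi u (φ i) a (φ k) b
  | nil g => nil g
  | cons (i := j) g s => ((f j).append (s.subst f)).precomp g

/-- The identity of `u_j`, and more generally the multimorphism `u_j ⟶ (a, b)` given by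
`a ⟶ u_j.1` and `u_j.2 ⟶ b`. -/
def unary {j : Fin n} {a b : X} (f : a ⟶ (u j).1) (g : (u j).2 ⟶ b) :
    Multi u j.castSucc a j.succ b :=
  cons f (nil g)

/-- The image of a multimorphism under a functor. -/
def map {Y : Type u} [Category.{v} Y] (G : X ⥤ Y) {i a k b} :
    Multi u i a k b → Multi (fun e => (G.obj (u e).1, G.obj (u e).2)) i (G.obj a) k (G.obj b)
  | nil f => nil (G.map f)
  | cons f s => cons (G.map f) (s.map G)

@[simp] lemma precomp_nil {i a a' b} (f : a' ⟶ a) (g : a ⟶ b) :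
    (nil g : Multi u i a i b).precomp f = nil (f ≫ g) := rfl

@[simp] lemma precomp_cons {i : Fin n} {a a' k b} (f : a' ⟶ a) (g : a ⟶ (u i).1)
    (s : Multi u i.succ (u i).2 k b) : (cons g s).precomp f = cons (f ≫ g) s := rfl

@[simp] lemma precomp_id {i a k b} (s : Multi u i a k b) : s.precomp (𝟙 a) = s := by
  cases s <;> simp

@[simp] lemma precomp_precomp {i a a' a'' k b} (f : a'' ⟶ a') (g : a' ⟶ a) (s : Multi u i a k b) :
    (s.precomp g).precomp f = s.precomp (f ≫ g) := by
  cases s <;> simp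

@[simp] lemma precomp_append {i a a' j b k c} (f : a' ⟶ a) (r : Multi u i a j b)
    (s : Multi u j b k c) : (r.precomp f).append s = (r.append s).precomp f := by
  cases r <;> simp [append]

lemma append_assoc {i a j b k c q d} (r : Multi u i a j b) (s : Multi u j b k c)
    (p : Multi u k c q d) : (r.append s).append p = r.append (s.append p) := by
  induction r with
  | nil f => simp [append]
  | cons f r ih => simp [append, ih]

section

variable {φ : Fin (m + 1) → Fin (n + 1)}
  (f : ∀ j : Fin m, Multi u (φ j.castSucc) (t j).1 (φ j.succ) (t j).2)

@[simp] lemma subst_precomp {i a a' k b} (g : a' ⟶ a) (s : Multi t i a k b) :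
    (s.precomp g).subst f = (s.subst f).precomp g := by
  cases s <;> simp [subst]

lemma subst_append {i a j b k c} (r : Multi t i a j b) (s : Multi t j b k c) :
    (r.append s).subst f = (r.subst f).append (s.subst f) := by
  induction r with
  | nil g => simp [append, subst]
  | cons g r ih => simp [append, subst, ih, append_assoc]

lemma subst_subst {ψ : Fin (l + 1) → Fin (m + 1)}
    (g : ∀ j : Fin l, Multi t (ψ j.castSucc) (w j).1 (ψ j.succ) (w j).2) {i a k b}
    (s : Multi w i a k b) :
    (s.subst g).subst f = s.subst (φ := φ ∘ ψ) (fun j => (g j).subst f) := by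
  induction s with
  | nil h => simp [subst]
  | cons h s ih => simp [subst, subst_append, ih]

lemma subst_unary {j : Fin m} {a b : X} (g : a ⟶ (t j).1) (h : (t j).2 ⟶ b) :
    (unary g h).subst f = ((f j).append (nil h)).precomp g := rfl

end

@[simp] lemma append_nil_id {i a k b} (s : Multi u i a k b) : s.append (nil (𝟙 b)) = s := by
  induction s with
  | nil f => simp [append]
  | cons f s ih => simp [append, ih]

lemma subst_id {i a k b} (s : Multi u i a k b) :
    s.subst (φ := id) (fun _ => unary (𝟙 _) (𝟙 _)) = s := by
  induction s with
  | nil f => rfl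
  | cons f s ih =>
    simp only [subst, ih]
    simp [unary, append]

section

variable {Y : Type u} [Category.{v} Y] (G G' : X ⥤ Y)

lemma map_precomp {i a a' k b} (f : a' ⟶ a) (s : Multi u i a k b) :
    (s.precomp f).map G = (s.map G).precomp (G.map f) := by
  cases s <;> simp [map]

lemma map_append {i a j b k c} (r : Multi u i a j b) (s : Multi u j b k c) :
    (r.append s).map G = (r.map G).append (s.map G) := by
  induction r with
  | nil f => simp [append, map, map_precomp]
  | cons f r ih => simp [append, map, ih]

lemma map_subst {φ : Fin (m + 1) → Fin (n + 1)}
    (f : ∀ j : Fin m, Multi u (φ j.castSucc) (t j).1 (φ j.succ) (t j).2) {i a k b}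
    (s : Multi t i a k b) :
    (s.subst f).map G = (s.map G).subst (φ := φ) (fun j => (f j).map G) := by
  induction s with
  | nil g => simp [subst, map]
  | cons g s ih => simp [subst, map, map_precomp, map_append, ih]

variable {G G'}

lemma subst_natIso (α : G ≅ G') {i a k b} (s : Multi u i a k b) :
    ((s.map G').subst (u := fun e => (G.obj (u e).1, G.obj (u e).2)) (φ := id)
      (fun e => unary (α.inv.app (u e).1) (α.hom.app (u e).2))).precomp (α.hom.app a) =
      (s.map G).append (nil (α.hom.app b)) := by
  induction s with
  | nil f => simp [map, subst, append]
  | cons f s ih =>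
    simp only [map, subst, append, unary, precomp_cons, ← ih]
    simp

end

end

end Multi

/-- An object of (the category of operators of) `O_X`: a finite sequence of pairs of objects of `X`,
which are attached to the edges of an object of `Δ`. -/
structure GHOperad (X : Type u) where
  base : SimplexCategory
  label : Fin base.len → X × X

namespace GHOperad

section

variable {X : Type u} [Category.{v} X]

/-- A morphism `s ⟶ t` of the category of operators of `O_X`: a morphism of `Ass = Δᵒᵖ`, given by a
monotone map `φ`, together with, for each edge `j` of the base of `t`, a multimorphism
`(s_{φ(j)}, …, s_{φ(j+1)-1}) ⟶ t_j`. -/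
@[ext]
structure Hom (s t : GHOperad X) where
  base : op s.base ⟶ op t.base
  multi : ∀ j : Fin t.base.len, Multi s.label (base.unop.toOrderHom j.castSucc) (t.label j).1
    (base.unop.toOrderHom j.succ) (t.label j).2

instance category : Category.{max u v} (GHOperad X) where
  Hom := Hom
  id s := ⟨𝟙 _, fun j => Multi.unary (𝟙 (s.label j).1) (𝟙 (s.label j).2)⟩
  comp {_ _ _} f g := ⟨f.base ≫ g.base, fun j => (g.multi j).subst f.multi⟩
  id_comp {_ _} f := Hom.ext (Category.id_comp _)
    (heq_of_eq (funext fun j => Multi.subst_id (f.multi j)))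
  comp_id {_ _} f := Hom.ext (Category.comp_id _) (heq_of_eq (funext fun j =>
    (Multi.subst_unary f.multi _ _).trans (by simp)))
  assoc {_ _ _ _} f g h := Hom.ext (Category.assoc _ _ _)
    (heq_of_eq (funext fun j => (Multi.subst_subst f.multi g.multi (h.multi j)).symm))

/-- The structural functor of the operad `O_X` to `Ass`. -/
def proj (X : Type u) [Category.{v} X] : GHOperad X ⥤ SimplexCategoryᵒᵖ where
  obj s := op s.base
  map f := Hom.base f

variable {Y : Type u} [Category.{v} Y]

/-- The action of a functor `G : X ⥤ Y` on the operads `O_X` and `O_Y`. -/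
def map (G : X ⥤ Y) : GHOperad X ⥤ GHOperad Y where
  obj s := ⟨s.base, fun e => (G.obj (s.label e).1, G.obj (s.label e).2)⟩
  map {s t} f := ⟨Hom.base (s := s) (t := t) f, fun j => (Hom.multi (s := s) (t := t) f j).map G⟩
  map_id s := Hom.ext rfl (heq_of_eq (funext fun j => by
    simp [CategoryStruct.id, Multi.unary, Multi.map]
    rfl))
  map_comp f g := Hom.ext rfl (heq_of_eq (funext fun j => Multi.map_subst G _ _))

lemma map_comp_proj (G : X ⥤ Y) : map G ⋙ proj Y = proj X := rfl

/-- The morphism over an identity of `Ass` that is given by the morphisms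
`G' (s_e.1) ⟶ G (s_e.1)` and `G (s_e.2) ⟶ G' (s_e.2)`. -/
def mapIsoHom {G G' : X ⥤ Y} (α : G ≅ G') (s : GHOperad X) : (map G).obj s ⟶ (map G').obj s :=
  Hom.mk (s := (map G).obj s) (t := (map G').obj s) (𝟙 (op s.base)) fun (e : Fin s.base.len) =>
    Multi.unary (u := fun e => (G.obj (s.label e).1, G.obj (s.label e).2))
      (α.inv.app (s.label e).1) (α.hom.app (s.label e).2)

lemma mapIsoHom_comp {G G' G'' : X ⥤ Y} (α : G ≅ G') (β : G' ≅ G'') (s : GHOperad X) :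
    mapIsoHom α s ≫ mapIsoHom β s = mapIsoHom (α ≪≫ β) s :=
  Hom.ext (Category.id_comp _) (heq_of_eq (funext fun (e : Fin s.base.len) => by
    let u : Fin s.base.len → Y × Y := fun e => (G.obj (s.label e).1, G.obj (s.label e).2)
    change ((Multi.unary (u := u) (α.inv.app (s.label e).1) (α.hom.app (s.label e).2)).append
        (Multi.nil (β.hom.app (s.label e).2))).precomp (β.inv.app (s.label e).1) =
      Multi.unary (u := u) ((α ≪≫ β).inv.app (s.label e).1) ((α ≪≫ β).hom.app (s.label e).2)
    simp [Multi.unary, Multi.append]))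

lemma mapIsoHom_refl (G : X ⥤ Y) (s : GHOperad X) : mapIsoHom (Iso.refl G) s = 𝟙 _ := rfl

/-- The action of a natural isomorphism on operads. -/
def mapIso {G G' : X ⥤ Y} (α : G ≅ G') : map G ≅ map G' :=
  NatIso.ofComponents
    (fun s =>
      { hom := mapIsoHom α s
        inv := mapIsoHom α.symm s
        hom_inv_id := by rw [mapIsoHom_comp, Iso.self_symm_id, mapIsoHom_refl]
        inv_hom_id := by rw [mapIsoHom_comp, Iso.symm_self_id, mapIsoHom_refl] })
    (fun {s t} f => Hom.ext ((Category.comp_id _).trans (Category.id_comp _).symm)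
      (heq_of_eq (funext fun (j : Fin t.base.len) => by
        have h := Multi.subst_natIso α (Hom.multi f j)
        have h' := congrArg (Multi.precomp (α.inv.app (t.label j).1)) h
        rw [Multi.precomp_precomp, Iso.inv_hom_id_app, Multi.precomp_id] at h'
        exact h'.symm)))

lemma mapIso_over {G G' : X ⥤ Y} (α : G ≅ G') :
    Functor.isoWhiskerRight (mapIso α) (proj Y) =
      eqToIso ((map_comp_proj G).trans (map_comp_proj G').symm) := rfl

end

end GHOperad

/-! ## Formal adjunctions between `F` and `O` -/

/-- A formal adjunction `F ⊣ O` between Hinich's functor `F : Δ_Ass ⥤ Cat^{≤1}` and the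
functor `O : Cat^{≤1} ⥤ Cat^{≤1}_Ass` of Gepner and Haugseng: isomorphisms of groupoids
`Fun_Ass(σ, O_X) ≅ Fun(F(σ), X)`, natural in the simplex `σ` of `Ass` and in the category `X`. Here
`Cat^{≤1}` is the `(2,1)`-category of categories, functors and natural isomorphisms. -/
structure FormalAdjunction where
  /-- The comparison functor. -/
  adj (σ : AssSimplex) (X : Type u) [Category.{v} X] :
    FunOver σ.functor (GHOperad.proj X) ⥤ Core (hinichF.obj σ ⥤ X)
  bijective_obj (σ : AssSimplex) (X : Type u) [Category.{v} X] :
    Function.Bijective (adj σ X).obj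
  bijective_map (σ : AssSimplex) (X : Type u) [Category.{v} X]
    (H K : FunOver σ.functor (GHOperad.proj X)) :
    Function.Bijective (fun e : H ⟶ K => (adj σ X).map e)
  /-- Naturality in `σ`. -/
  naturality_left {σ τ : AssSimplex} (f : σ ⟶ τ) (X : Type u) [Category.{v} X] :
    FunOver.precomp f.toOrderHom.monotone.functor f.w (GHOperad.proj X) ⋙ adj σ X =
      adj τ X ⋙ ((Functor.whiskeringLeft _ _ X).obj (hinichF.map f).toFunctor).core
  /-- Naturality with respect to functors `X ⥤ Y`. -/
  naturality_right (σ : AssSimplex) {X Y : Type u} [Category.{v} X] [Category.{v} Y] (G : X ⥤ Y) :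
    FunOver.postcomp σ.functor (GHOperad.map G) (GHOperad.map_comp_proj G) ⋙ adj σ Y =
      adj σ X ⋙ ((Functor.whiskeringRight _ _ _).obj G).core
  /-- Naturality with respect to natural isomorphisms of functors `X ⥤ Y`. -/
  naturality_iso (σ : AssSimplex) {X Y : Type u} [Category.{v} X] [Category.{v} Y] {G G' : X ⥤ Y}
    (α : G ≅ G') (H : FunOver σ.functor (GHOperad.proj X)) :
    Arrow.mk ((adj σ Y).map (FunOver.postcompIso (GHOperad.map_comp_proj G)
      (GHOperad.map_comp_proj G') (GHOperad.mapIso α) (GHOperad.mapIso_over α) H)) =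
    Arrow.mk (X := Core.mk (((adj σ X).obj H).of ⋙ G)) (Y := Core.mk (((adj σ X).obj H).of ⋙ G'))
      (CoreHom.mk (Functor.isoWhiskerLeft ((adj σ X).obj H).of α))

namespace FormalAdjunction

section

variable {σ : AssSimplex} {X : Type u} [Category.{v} X]

lemma base_eq (H : FunOver σ.functor (GHOperad.proj X)) (a : Fin (σ.dim + 1)) :
    σ.vertex a = (H.functor.obj a).base :=
  congrArg unop (Functor.congr_obj H.w a).symm

/-- An edge of `σ_a`, as an edge of the base of the object `H(a)` of `O_X` over `σ_a`. -/
def castEdge (H : FunOver σ.functor (GHOperad.proj X)) (a : Fin (σ.dim + 1))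
    (e : Fin (σ.vertex a).len) : Fin (H.functor.obj a).base.len :=
  Fin.cast (congrArg SimplexCategory.len (base_eq H a)) e

end

/-- The formal adjunction is given by the labelling of Hinich's diagrams with the variables of
Gepner and Haugseng. -/
structure IsLabelling (A : FormalAdjunction.{v, u}) : Prop where
  /-- The objects `x_e` and `y_e` are labelled with the two components of the pair `u_e`. -/
  obj_x (σ : AssSimplex) (X : Type u) [Category.{v} X] (H : FunOver σ.functor (GHOperad.proj X))
    (a : Fin (σ.dim + 1)) (e : Fin (σ.vertex a).len) :
    ((A.adj σ X).obj H).of.obj (⟨a, e, .x⟩ : AssSimplex.F₀ σ) =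
      ((H.functor.obj a).label (castEdge H a e)).1
  obj_y (σ : AssSimplex) (X : Type u) [Category.{v} X] (H : FunOver σ.functor (GHOperad.proj X))
    (a : Fin (σ.dim + 1)) (e : Fin (σ.vertex a).len) :
    ((A.adj σ X).obj H).of.obj (⟨a, e, .y⟩ : AssSimplex.F₀ σ) =
      ((H.functor.obj a).label (castEdge H a e)).2
  /-- The arrow `p → q` at the vertex `i`, in the component of the edge `j`, is labelled with the
  corresponding member of the family of morphisms that constitutes the `j`-th multimorphism. -/
  map (σ : AssSimplex) (X : Type u) [Category.{v} X] (H : FunOver σ.functor (GHOperad.proj X))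
    (a b : Fin (σ.dim + 1)) (h : a ≤ b) (j : Fin (σ.vertex b).len)
    (i : Fin ((σ.vertex a).len + 1)) (p q : AssSimplex.F₀ σ) (hpq : σ.IsArrow h j i p q) :
    (GHOperad.Hom.multi (H.functor.map (homOfLE h)) (castEdge H b j)).arrows[
      (i : ℕ) - σ.arrow h j.castSucc]? =
      some (Arrow.mk (((A.adj σ X).obj H).of.map
        (homOfLE (AssSimplex.IsArrow.le h j i p q hpq) : p ⟶ q)))
  /-- An isomorphism `u ≅ u'` over an identity of `Ass` is a family of pairs of isomorphisms
  `u'_e.1 ⟶ u_e.1` and `u_e.2 ⟶ u'_e.2`; the first is inverse to the component at `x_e`, and the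
  second is the component at `y_e`. -/
  iso (σ : AssSimplex) (X : Type u) [Category.{v} X] (H K : FunOver σ.functor (GHOperad.proj X))
    (ε : H ⟶ K) (a : Fin (σ.dim + 1)) (e : Fin (σ.vertex a).len) :
    (GHOperad.Hom.multi (ε.1.hom.app a) (castEdge K a e)).arrows =
      [Arrow.mk (((A.adj σ X).map ε).iso.inv.app (⟨a, e, .x⟩ : AssSimplex.F₀ σ)),
        Arrow.mk (((A.adj σ X).map ε).iso.hom.app (⟨a, e, .y⟩ : AssSimplex.F₀ σ))]

end FormalAdjunction

/-!
The adjunction is governed by a universal element. In an ordered set there is at most one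
multimorphism with given inputs and output (`Multi.subsingleton_of_isThin`), so the arrows of
Hinich's diagrams for all edges `σ_a ⟶ σ_b` assemble, without any further verification, into a
functor from `σ` to the operad of `F(σ)` over `Ass`, `AssSimplex.universal`. A functor
`Φ : F(σ) ⥤ X` sends it to a simplex of `O_X`, and a natural isomorphism of such functors gives an
isomorphism of simplices. This functor, `AssSimplex.realization`, is visibly natural in `σ` and `X`,
and the members of the multimorphisms of the realization of `Φ` are the values of `Φ` on Hinich's
arrows. The adjunction is its inverse.

It remains to see that the realization is bijective on objects and fully faithful. Both rest on the
fact that `F(σ)` is the free category on Hinich's graph, so that a functor on `F(σ)` amounts to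
values on the vertices and on the arrows of the graph (`AssSimplex.liftGraph`,
`AssSimplex.functor_ext`). Freeness means that paths with given ends are unique
(`AssSimplex.subsingleton_path`): each vertex is the target of at most one arrow, and there are no
cycles because the arrows strictly increase a lexicographic rank (`AssSimplex.GraphArrow.rank_lt`).
Now a simplex `H` of `O_X` prescribes values on the vertices and on the arrows, hence a functor
`Φ`; its realization agrees with `H` on the edges `σ_a ⟶ σ_{a+1}`, and thus everywhere. An
isomorphism of simplices over `Ass` is a family of pairs of isomorphisms of `X`, and comparing the
members of the multimorphisms in its naturality square at `σ_a ⟶ σ_{a+1}` shows that the pairs are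
natural on the arrows of the graph (`Multi.natural_of_subst_eq`), hence on `F(σ)`.
-/

/-! ### Families of morphisms -/

namespace Multi

variable {X : Type u} [Category.{v} X] {n : ℕ} {w : Fin n → X × X}

lemma le {i a k b} (s : Multi w i a k b) : i ≤ k := by
  induction s with
  | nil f => exact le_rfl
  | cons f s ih => exact (Fin.castSucc_le_succ _).trans ih

lemma exists_eq_nil {i a b} (s : Multi w i a i b) : ∃ f, s = nil f := by
  generalize hk : i = k at s
  cases s with
  | nil f => cases hk; exact ⟨f, rfl⟩
  | cons f s =>
    have := s.le
    rw [← hk, hk, Fin.le_def, Fin.val_succ, Fin.val_castSucc] at this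
    omega

lemma exists_eq_cons {i : Fin n} {a k b} (s : Multi w i.castSucc a k b) (h : i.succ ≤ k) :
    ∃ f s', s = cons f s' := by
  have key : ∀ {i'} (s : Multi w i' a k b), i.castSucc = i' → ∃ (f : a ⟶ (w i).1)
      (s' : Multi w i.succ (w i).2 k b), s ≍ cons f s' := by
    intro i' s hi
    cases s with
    | nil f =>
      rw [← hi, Fin.le_def, Fin.val_succ, Fin.val_castSucc] at h
      omega
    | cons f s =>
      obtain rfl := Fin.castSucc_injective _ hi
      exact ⟨f, s, HEq.rfl⟩
  obtain ⟨f, s', hs⟩ := key s rfl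
  exact ⟨f, s', eq_of_heq hs⟩

lemma exists_eq_unary {j : Fin n} {a b} (s : Multi w j.castSucc a j.succ b) :
    ∃ f g, s = unary f g := by
  obtain ⟨f, s, rfl⟩ := s.exists_eq_cons le_rfl
  obtain ⟨g, rfl⟩ := s.exists_eq_nil
  exact ⟨f, g, rfl⟩

lemma unary_inj {j : Fin n} {a b : X} {f f' : a ⟶ (w j).1} {g g' : (w j).2 ⟶ b} :
    (unary f g : Multi w _ _ _ _) = unary f' g' ↔ f = f' ∧ g = g' := by
  simp [unary]

lemma precomp_hom_precomp_inv {i a a' k b} (f : a ≅ a') (s : Multi w i a k b) :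
    (s.precomp f.inv).precomp f.hom = s := by simp

/-- A multimorphism with given inputs and output is determined by its members. -/
lemma arrows_injective {i a k b} {s s' : Multi w i a k b} (h : s.arrows = s'.arrows) :
    s = s' := by
  induction s with
  | nil f =>
    obtain ⟨f', rfl⟩ := s'.exists_eq_nil
    simp only [arrows, List.cons.injEq, Arrow.mk_inj, and_true] at h
    rw [h]
  | cons f s ih =>
    obtain ⟨f', s', rfl⟩ := s'.exists_eq_cons s.le
    simp only [arrows, List.cons.injEq, Arrow.mk_inj] at h
    rw [h.1, ih h.2]

lemma subsingleton_of_isThin [Quiver.IsThin X] {i a k b} (s s' : Multi w i a k b) : s = s' := by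
  induction s with
  | nil f =>
    obtain ⟨f', rfl⟩ := s'.exists_eq_nil
    rw [Subsingleton.elim f f']
  | cons f s ih =>
    obtain ⟨f', s', rfl⟩ := s'.exists_eq_cons s.le
    rw [Subsingleton.elim f f', ih s']

lemma length_arrows {i a k b} (s : Multi w i a k b) :
    s.arrows.length = (k : ℕ) - i + 1 := by
  induction s with
  | nil f => simp [arrows]
  | cons f s ih =>
    have := Fin.le_def.1 s.le
    simp only [arrows, List.length_cons, ih, Fin.val_succ, Fin.val_castSucc] at this ⊢
    omega

lemma left_arrows_zero {i a k b} (s : Multi w i a k b) :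
    s.arrows[0]?.map (·.left) = some a := by
  cases s <;> rfl

lemma right_arrows_last {i a k b} (s : Multi w i a k b) :
    s.arrows[(k : ℕ) - i]?.map (·.right) = some b := by
  induction s with
  | nil f => simp [arrows]
  | @cons i a k b f s ih =>
    have := Fin.le_def.1 s.le
    rw [Fin.val_succ] at this ih
    rw [show (k : ℕ) - i.castSucc = (k : ℕ) - (i + 1) + 1 by rw [Fin.val_castSucc]; omega]
    exact ih

lemma left_arrows_inner {i a k b} (s : Multi w i a k b) (e : Fin n) (hl : i ≤ e.castSucc)
    (hr : e.succ ≤ k) : s.arrows[(e.succ : ℕ) - i]?.map (·.left) = some (w e).2 := by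
  induction s with
  | nil f => simp only [Fin.le_def, Fin.val_succ, Fin.val_castSucc] at hl hr; omega
  | @cons i a k b f s ih =>
    rw [Fin.le_def] at hl
    simp only [Fin.val_castSucc, Fin.val_succ] at hl ih ⊢
    rw [show (e : ℕ) + 1 - i = (e : ℕ) - i + 1 by omega]
    rcases hl.eq_or_lt with h | h
    · obtain rfl : i = e := Fin.ext h
      rw [Nat.sub_self]
      exact s.left_arrows_zero
    · have := ih (Fin.le_def.2 h) hr
      rwa [show (e : ℕ) + 1 - (i + 1) = e - i by omega] at this

lemma right_arrows_inner {i a k b} (s : Multi w i a k b) (e : Fin n) (hl : i ≤ e.castSucc)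
    (hr : e.succ ≤ k) : s.arrows[(e.castSucc : ℕ) - i]?.map (·.right) = some (w e).1 := by
  induction s with
  | nil f => simp only [Fin.le_def, Fin.val_succ, Fin.val_castSucc] at hl hr; omega
  | @cons i a k b f s ih =>
    rw [Fin.le_def] at hl
    simp only [Fin.val_castSucc, Fin.val_succ] at hl ih ⊢
    rcases hl.eq_or_lt with h | h
    · obtain rfl : i = e := Fin.ext h
      rw [Nat.sub_self]
      rfl
    · have := ih (Fin.le_def.2 h) hr
      rwa [show (e : ℕ) - i = e - (i + 1) + 1 by omega]

variable {Y : Type u} [Category.{v} Y] (G G' : X ⥤ Y)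

lemma arrows_map {i a k b} (s : Multi w i a k b) :
    (s.map G).arrows = s.arrows.map G.mapArrow.obj := by
  induction s with
  | nil f => rfl
  | cons f s ih => exact congrArg _ ih

lemma map_map {Z : Type u} [Category.{v} Z] (G : X ⥤ Y) (K : Y ⥤ Z) {i a k b}
    (s : Multi w i a k b) : (s.map G).map K = s.map (G ⋙ K) := by
  induction s with
  | nil f => rfl
  | cons f s ih => exact congrArg _ ih

variable {G G'}

/-- If substitution of the pairs `(α⁻¹, α)` turns the image under `G'` of a family into its image
under `G`, then `α` is natural with respect to all members of the family. -/
lemma natural_of_subst_eq (α : ∀ c, G.obj c ≅ G'.obj c) {i a k b} (s : Multi w i a k b)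
    (h : ((s.map G').subst (u := fun e => (G.obj (w e).1, G.obj (w e).2)) (φ := id)
      (fun e => unary (α (w e).1).inv (α (w e).2).hom)).precomp (α a).hom =
      (s.map G).append (nil (α b).hom)) :
    ∀ f ∈ s.arrows, G.map f.hom ≫ (α f.right).hom = (α f.left).hom ≫ G'.map f.hom := by
  induction s with
  | nil f =>
    simp only [map, subst, append, precomp_nil, nil.injEq] at h
    simpa [arrows] using h.symm
  | cons f s ih =>
    obtain ⟨h₁, h₂⟩ := cons.inj h
    simp only [arrows, List.mem_cons, forall_eq_or_imp]
    refine ⟨?_, ih h₂⟩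
    change _ ≫ _ ≫ _ = _ at h₁
    rw [← Category.assoc, Iso.comp_inv_eq] at h₁
    exact h₁.symm

end Multi

/-! ### Functors out of Hinich's diagrams -/

namespace AssSimplex

variable {σ : AssSimplex}

section Arrows

variable {a b : Fin (σ.dim + 1)} {h : a ≤ b} {j : Fin (σ.vertex b).len}
  {i : Fin ((σ.vertex a).len + 1)} {p q : F₀ σ}

lemma arrow_castSucc_le_succ (h : a ≤ b) (j : Fin (σ.vertex b).len) :
    σ.arrow h j.castSucc ≤ σ.arrow h j.succ :=
  (σ.arrow h).monotone (Fin.castSucc_le_succ j)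

lemma ArrowSource.le_index (hp : ArrowSource σ h j i p) : σ.arrow h j.castSucc ≤ i := by
  cases hp with
  | first => exact le_rfl
  | inner e hl hr => exact hl.trans (Fin.castSucc_le_succ e)

lemma exists_arrowSource (hl : σ.arrow h j.castSucc ≤ i) (hr : i ≤ σ.arrow h j.succ) :
    ∃ p, ArrowSource σ h j i p := by
  rcases hl.eq_or_lt with rfl | hlt
  · exact ⟨_, ArrowSource.first⟩
  · obtain ⟨e, rfl⟩ := Fin.exists_succ_eq.2 (Fin.ne_zero_of_lt hlt)
    exact ⟨_, ArrowSource.inner e (Fin.le_castSucc_iff.2 hlt) hr⟩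

lemma ArrowSource.unique (hp : ArrowSource σ h j i p) (hq : ArrowSource σ h j i q) : p = q := by
  generalize hi : i = i' at hq
  cases hp with
  | first =>
    cases hq with
    | first => rfl
    | inner e hl hr => rw [hi] at hl; simp [Fin.le_def] at hl
  | inner e hl hr =>
    cases hq with
    | first => rw [← hi] at hl; simp [Fin.le_def] at hl
    | inner e' hl' hr' => rw [Fin.succ_injective _ hi]

/-- Each vertex of Hinich's graph is the target of at most one arrow. -/
lemma ArrowTarget.index_unique {a' b' : Fin (σ.dim + 1)} {h' : a' ≤ b'}
    {j' : Fin (σ.vertex b').len} {i' : Fin ((σ.vertex a').len + 1)}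
    (hq : ArrowTarget σ h j i q) (hq' : ArrowTarget σ h' j' i' q)
    (hab : (a : ℕ) + 1 = b) (hab' : (a' : ℕ) + 1 = b') :
    a = a' ∧ b = b' ∧ j ≍ j' ∧ i ≍ i' := by
  cases hq with
  | last =>
    cases hq' with
    | last =>
      obtain rfl : a = a' := Fin.ext (by omega)
      exact ⟨rfl, rfl, HEq.rfl, HEq.rfl⟩
  | inner e hl hr =>
    cases hq' with
    | inner _ hl' hr' =>
      obtain rfl : b = b' := Fin.ext (by omega)
      have key : ∀ {j j' : Fin (σ.vertex b).len}, e.succ ≤ σ.arrow h j.succ →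
          σ.arrow h j'.castSucc ≤ e.castSucc → j' ≤ j := by
        intro j j' hr hl
        by_contra! hlt
        have := hr.trans (((σ.arrow h).monotone (Fin.le_castSucc_iff.2
          (Fin.succ_lt_succ_iff.2 hlt) : j.succ ≤ j'.castSucc)).trans hl)
        simp [Fin.le_def] at this
      obtain rfl : j = j' := le_antisymm (key hr' hl) (key hr hl')
      exact ⟨rfl, rfl, HEq.rfl, HEq.rfl⟩

end Arrows

/-- The vertex of `σ_a` at which the object `x_e` or `y_e` in level `a` sits: the initial vertex
of `e` for `x_e`, the final one for `y_e`. -/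
def F₀.point (p : F₀ σ) : Fin ((σ.vertex p.level).len + 1) :=
  match p.side with
  | .x => p.edge.castSucc
  | .y => p.edge.succ

/-- The images of the vertex of `p` in all lower levels, padded in the higher levels by a
value smaller (for `y`) or larger (for `x`) than all vertices. The vertices of all levels form a
forest; the arrows of Hinich's graph traverse it depth first, where `y` enters the subtree of a
vertex and `x` leaves it, so that the lexicographic order of these sequences increases. -/
def F₀.rank (p : F₀ σ) : Lex (Fin (σ.dim + 1) → ℕ) := toLex fun c =>
  if h : c ≤ p.level then σ.arrow h p.point + 1 else
    match p.side with
    | .x => (σ.vertex c).len + 2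
    | .y => 0

lemma F₀.rank_of_le {c : Fin (σ.dim + 1)} (p : F₀ σ) (h : c ≤ p.level) :
    ofLex p.rank c = σ.arrow h p.point + 1 := dif_pos h

lemma GraphArrow.rank_lt {p q : F₀ σ} (hpq : σ.GraphArrow p q) : p.rank < q.rank := by
  obtain ⟨a, b, hab, j, i, hp, hq⟩ := hpq
  have h : a ≤ b := Fin.le_def.2 (by omega)
  have hn : ¬ b ≤ a := by rw [Fin.le_def]; omega
  -- below level `b`, both sequences consist of the images of `i`
  have hsrc : ∀ c (hc : c ≤ a), ofLex p.rank c = σ.arrow hc i + 1 := by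
    intro c hc
    cases hp with
    | first =>
      rw [F₀.rank_of_le _ (hc.trans h), arrow_trans σ hc h]
      rfl
    | inner e hl hr => exact F₀.rank_of_le _ hc
  have htgt : ∀ c (hc : c ≤ a), ofLex q.rank c = σ.arrow hc i + 1 := by
    intro c hc
    cases hq with
    | last =>
      rw [F₀.rank_of_le _ (hc.trans h), arrow_trans σ hc h]
      rfl
    | inner e hl hr => exact F₀.rank_of_le _ hc
  refine ⟨b, fun c hc => ?_, ?_⟩
  · have hc' : c ≤ a := Fin.le_def.2 (by have := Fin.lt_def.1 hc; omega)
    exact (hsrc c hc').trans (htgt c hc').symm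
  · change ofLex p.rank b < ofLex q.rank b
    have hp' : ofLex p.rank b = (j : ℕ) + 1 ∨ ofLex p.rank b = 0 := by
      cases hp with
      | first =>
        rw [F₀.rank_of_le _ (le_refl b), arrow_rfl]
        exact Or.inl rfl
      | inner e hl hr => exact Or.inr (dif_neg hn)
    have hq' : ofLex q.rank b = (j : ℕ) + 2 ∨ ofLex q.rank b = (σ.vertex b).len + 2 := by
      cases hq with
      | last =>
        rw [F₀.rank_of_le _ (le_refl b), arrow_rfl]
        exact Or.inl rfl
      | inner e hl hr => exact Or.inr (dif_neg hn)
    have := j.2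
    omega

lemma GraphArrow.source_unique {p p' q : F₀ σ} (h : σ.GraphArrow p q) (h' : σ.GraphArrow p' q) :
    p = p' := by
  obtain ⟨a, b, hab, j, i, hp, hq⟩ := h
  obtain ⟨a', b', hab', j', i', hp', hq'⟩ := h'
  obtain ⟨rfl, rfl, hj, hi⟩ := hq.index_unique hq' hab hab'
  obtain rfl := eq_of_heq hj
  obtain rfl := eq_of_heq hi
  exact hp.unique hp'

/-- The oriented graph `F^Grf(σ)`, a type synonym of the set of its vertices. -/
def Graph (σ : AssSimplex) := F₀ σ

instance : Quiver (Graph σ) where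
  Hom p q := PLift (σ.GraphArrow p q)

lemma rank_le_of_path {p q : Graph σ} (s : Quiver.Path p q) : F₀.rank p ≤ F₀.rank q := by
  induction s with
  | nil => exact le_rfl
  | cons s f ih => exact ih.trans f.down.rank_lt.le

/-- The free category on Hinich's graph is an ordered set. -/
instance subsingleton_path (p q : Graph σ) : Subsingleton (Quiver.Path p q) where
  allEq s t := by
    induction s with
    | nil =>
      cases t with
      | nil => rfl
      | cons t f => exact absurd f.down.rank_lt (rank_le_of_path t).not_gt
    | cons s f ih =>
      cases t with
      | nil => exact absurd f.down.rank_lt (rank_le_of_path s).not_gt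
      | cons t g =>
        obtain rfl := f.down.source_unique g.down
        rw [ih t]
        change t.cons (PLift.up f.down) = t.cons (PLift.up g.down)
        rfl

lemma nonempty_path {p q : F₀ σ} (h : p ≤ q) :
    Nonempty (Quiver.Path (V := Graph σ) p q) := by
  induction (h : Relation.ReflTransGen σ.GraphArrow p q) with
  | refl => exact ⟨.nil⟩
  | tail _ g ih => exact ⟨ih.some.cons ⟨g⟩⟩

section Lift

variable {X : Type u} [Category.{v} X]

/-- The functor from the free category on Hinich's graph with given values on the vertices and on
the arrows. -/
def pathFunctor (l : F₀ σ → X) (φ : ∀ p q : F₀ σ, σ.GraphArrow p q → (l p ⟶ l q)) :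
    Paths (Graph σ) ⥤ X :=
  Paths.lift
    { obj := l
      map := fun {p q} (g : PLift (σ.GraphArrow p q)) => φ p q g.down }

/-- The functor on `F(σ)` with given values on the vertices and on the arrows of Hinich's graph. -/
noncomputable def liftGraph (l : F₀ σ → X) (φ : ∀ p q : F₀ σ, σ.GraphArrow p q → (l p ⟶ l q)) :
    F₀ σ ⥤ X where
  obj := l
  map h := (pathFunctor l φ).map (nonempty_path (leOfHom h)).some
  map_id p := (congrArg _ ((subsingleton_path p p).elim _ .nil)).trans
    ((pathFunctor l φ).map_id (p : Paths (Graph σ)))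
  map_comp {p _ r} _ _ := (congrArg _ ((subsingleton_path p r).elim _ _)).trans
    ((pathFunctor l φ).map_comp _ _)

lemma liftGraph_map (l : F₀ σ → X) (φ : ∀ p q : F₀ σ, σ.GraphArrow p q → (l p ⟶ l q))
    {p q : F₀ σ} (h : σ.GraphArrow p q) : (liftGraph l φ).map (homOfLE h.le) = φ p q h :=
  (congrArg (pathFunctor l φ).map ((subsingleton_path p q).elim _ _)).trans
    (Paths.lift_toPath (V := Graph σ) _ (X := p) (Y := q) (PLift.up h))

/-- Functors on `F(σ)` agree if they agree on the vertices and on the arrows of Hinich's graph. -/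
lemma functor_ext {Φ Ψ : F₀ σ ⥤ X} (hobj : ∀ p, Φ.obj p = Ψ.obj p)
    (hmap : ∀ p q (h : σ.GraphArrow p q),
      Arrow.mk (Φ.map (homOfLE h.le)) = Arrow.mk (Ψ.map (homOfLE h.le))) : Φ = Ψ := by
  refine CategoryTheory.Functor.ext hobj fun p q f => ?_
  have hpq : Relation.ReflTransGen σ.GraphArrow p q := leOfHom f
  rw [Subsingleton.elim f (homOfLE hpq)]
  clear f
  induction hpq with
  | refl =>
    rw [Subsingleton.elim (homOfLE _) (𝟙 p)]
    simp
  | tail h g ih =>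
    obtain ⟨_, _, hg⟩ := (Arrow.mk_eq_mk_iff _ _).1 (hmap _ _ g)
    rw [← homOfLE_comp h (GraphArrow.le g), Functor.map_comp, Functor.map_comp, ih, hg]
    simp

/-- Naturality on `F(σ)` can be checked on the arrows of Hinich's graph. -/
lemma natural_of_graphArrow {Φ Ψ : F₀ σ ⥤ X} (α : ∀ p, Φ.obj p ⟶ Ψ.obj p)
    (hα : ∀ p q (h : σ.GraphArrow p q),
      Φ.map (homOfLE h.le) ≫ α q = α p ≫ Ψ.map (homOfLE h.le)) {p q : F₀ σ} (f : p ⟶ q) :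
    Φ.map f ≫ α q = α p ≫ Ψ.map f := by
  have hpq : Relation.ReflTransGen σ.GraphArrow p q := leOfHom f
  rw [Subsingleton.elim f (homOfLE hpq)]
  clear f
  induction hpq with
  | refl =>
    rw [Subsingleton.elim (homOfLE _) (𝟙 p)]
    simp
  | tail h g ih =>
    rw [← homOfLE_comp h (GraphArrow.le g), Functor.map_comp, Functor.map_comp, Category.assoc,
      hα _ _ g, reassoc_of% ih]

end Lift

section Members

variable {X : Type u} [Category.{v} X] (l : F₀ σ → X) {a b : Fin (σ.dim + 1)} {h : a ≤ b}
  {j : Fin (σ.vertex b).len} {i : Fin ((σ.vertex a).len + 1)} {p q : F₀ σ}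

/-- A labelling of the objects of Hinich's diagram, as a family of pairs for each level. -/
abbrev pairs (a : Fin (σ.dim + 1)) (e : Fin (σ.vertex a).len) : X × X :=
  (l ⟨a, e, .x⟩, l ⟨a, e, .y⟩)

variable {l}

lemma left_arrows_of_source
    (s : Multi (pairs l a) (σ.arrow h j.castSucc) (l ⟨b, j, .x⟩) (σ.arrow h j.succ) (l ⟨b, j, .y⟩))
    (hp : ArrowSource σ h j i p) :
    s.arrows[(i : ℕ) - σ.arrow h j.castSucc]?.map (·.left) = some (l p) := by
  cases hp with
  | first => rw [Nat.sub_self]; exact s.left_arrows_zero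
  | inner e hl hr => exact s.left_arrows_inner e hl hr

lemma right_arrows_of_target
    (s : Multi (pairs l a) (σ.arrow h j.castSucc) (l ⟨b, j, .x⟩) (σ.arrow h j.succ) (l ⟨b, j, .y⟩))
    (hq : ArrowTarget σ h j i q) :
    s.arrows[(i : ℕ) - σ.arrow h j.castSucc]?.map (·.right) = some (l q) := by
  cases hq with
  | last => exact s.right_arrows_last
  | inner e hl hr => exact s.right_arrows_inner e hl hr

/-- The member at the vertex `i` of a family labelled by `l` goes from the label of the source to
the label of the target of the arrow at `i` in Hinich's diagram. -/
lemma exists_arrows_eq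
    (s : Multi (pairs l a) (σ.arrow h j.castSucc) (l ⟨b, j, .x⟩) (σ.arrow h j.succ) (l ⟨b, j, .y⟩))
    (hpq : σ.IsArrow h j i p q) :
    ∃ f : l p ⟶ l q, s.arrows[(i : ℕ) - σ.arrow h j.castSucc]? = some (Arrow.mk f) := by
  obtain ⟨f, hf, hl⟩ := Option.map_eq_some_iff.1 (left_arrows_of_source s hpq.1)
  have hr := right_arrows_of_target s hpq.2
  rw [hf, Option.map_some, Option.some.injEq] at hr
  obtain ⟨c, d, f⟩ := f
  obtain rfl : c = l p := hl
  obtain rfl : d = l q := hr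
  exact ⟨f, hf⟩

/-- Two lists with one entry for each arrow in the component of `j` agree if their entries at all
these arrows agree. -/
lemma arrows_eq_of_isArrow {A B : List (Arrow X)}
    (hA : A.length = (σ.arrow h j.succ : ℕ) - σ.arrow h j.castSucc + 1) (hB : B.length = A.length)
    (H : ∀ i p q, σ.IsArrow h j i p q →
      A[(i : ℕ) - σ.arrow h j.castSucc]? = B[(i : ℕ) - σ.arrow h j.castSucc]?) : A = B := by
  have hle := Fin.le_def.1 (arrow_castSucc_le_succ h j)
  refine List.ext_getElem? fun t => ?_
  by_cases ht : t < A.length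
  · have hb := (σ.arrow h j.succ).2
    let i : Fin ((σ.vertex a).len + 1) := ⟨σ.arrow h j.castSucc + t, by omega⟩
    have hl : σ.arrow h j.castSucc ≤ i := Fin.le_def.2 (Nat.le_add_right _ _)
    have hr : i ≤ σ.arrow h j.succ := Fin.le_def.2 (by simp only [i]; omega)
    obtain ⟨p, hp⟩ := exists_arrowSource hl hr
    obtain ⟨q, hq⟩ := exists_arrowTarget h j i hl hr
    simpa [i] using H i p q ⟨hp, hq⟩
  · rw [List.getElem?_eq_none (by omega), List.getElem?_eq_none (by omega)]

end Members

end AssSimplex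

/-! ### The universal diagram -/

namespace GHOperad

variable {X : Type u} [Category.{v} X]

/-- Morphisms of the category of operators agree if they lie over the same monotone map and their
multimorphisms have the same members. -/
lemma hom_ext_arrows {s t : GHOperad X} {f g : s ⟶ t} (hb : Hom.base f = Hom.base g)
    (hm : ∀ j, (Hom.multi f j).arrows = (Hom.multi g j).arrows) : f = g := by
  obtain ⟨b, f⟩ := f
  obtain ⟨b', g⟩ := g
  obtain rfl : b = b' := hb
  exact Hom.ext rfl (heq_of_eq (funext fun j => Multi.arrows_injective (hm j)))

lemma hom_ext_of_isThin [Quiver.IsThin X] {s t : GHOperad X} {f g : s ⟶ t}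
    (hb : Hom.base f = Hom.base g) : f = g := by
  obtain ⟨b, f⟩ := f
  obtain ⟨b', g⟩ := g
  obtain rfl : b = b' := hb
  exact Hom.ext rfl (heq_of_eq (funext fun j => Multi.subsingleton_of_isThin _ _))

lemma map_comp_functor {Y Z : Type u} [Category.{v} Y] [Category.{v} Z] (G : X ⥤ Y) (K : Y ⥤ Z) :
    map G ⋙ map K = map (G ⋙ K) :=
  CategoryTheory.Functor.ext (fun _ => rfl) fun _ _ f =>
    Eq.trans (b := (map (G ⋙ K)).map f)
      (Hom.ext rfl (heq_of_eq (funext fun _ => Multi.map_map G K _)))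
      ((Category.id_comp _).trans (Category.comp_id _)).symm

end GHOperad

namespace AssSimplex

/-- The ordered set `F(σ)` as a category in given universes; the action of functors on operads is
defined only between categories in the same universes. -/
structure Lifted (σ : AssSimplex) : Type u where
  down : F₀ σ

namespace Lifted

variable (σ : AssSimplex)

instance : Category.{v} (Lifted.{u} σ) where
  Hom p q := ULift (PLift (p.down ≤ q.down))
  id p := ⟨⟨le_rfl⟩⟩
  comp f g := ⟨⟨f.down.down.trans g.down.down⟩⟩

instance : Quiver.IsThin (Lifted.{u} σ) := fun _ _ =>
  ⟨fun _ _ => ULift.down_injective (PLift.down_injective rfl)⟩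

variable {σ}

/-- The morphism given by an inequality. -/
def homMk {p q : F₀ σ} (h : p ≤ q) : (⟨p⟩ : Lifted.{u} σ) ⟶ ⟨q⟩ := ⟨⟨h⟩⟩

variable (σ)

/-- The functor to `F(σ)` that forgets the change of universes. -/
def downFunctor : Lifted.{u} σ ⥤ F₀ σ where
  obj p := p.down
  map f := homOfLE f.down.down

variable {σ}

/-- The functoriality of `Lifted`. -/
def map {τ : AssSimplex} (f : σ ⟶ τ) : Lifted.{u} σ ⥤ Lifted.{u} τ where
  obj p := ⟨F₀.map f p.down⟩
  map g := ⟨⟨F₀.map_monotone f g.down.down⟩⟩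

end Lifted

variable {σ : AssSimplex} {a b : Fin (σ.dim + 1)}

/-- The arrows of Hinich's diagram from the vertex `i` on form a multimorphism; it is built
backwards from the last vertex of the interval of `j`, at distance `d` from `i`. -/
lemma nonempty_multi_of_source (h : a ≤ b) (j : Fin (σ.vertex b).len) (d : ℕ) :
    ∀ (i : Fin ((σ.vertex a).len + 1)) (p : F₀ σ), (i : ℕ) + d = σ.arrow h j.succ →
      ArrowSource σ h j i p →
      Nonempty (Multi (pairs (Lifted.mk.{u} (σ := σ)) a) i ⟨p⟩ (σ.arrow h j.succ) ⟨⟨b, j, .y⟩⟩) := by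
  induction d with
  | zero =>
    intro i p hi hp
    obtain rfl : i = σ.arrow h j.succ := Fin.ext hi
    exact ⟨.nil (Lifted.homMk (IsArrow.le h j _ _ _ ⟨hp, .last⟩))⟩
  | succ d ih =>
    intro i p hi hp
    obtain ⟨e, rfl⟩ : ∃ e : Fin (σ.vertex a).len, i = e.castSucc :=
      ⟨⟨i, by have := (σ.arrow h j.succ).2; omega⟩, rfl⟩
    have hr : e.succ ≤ σ.arrow h j.succ := Fin.le_def.2 (by rw [Fin.val_succ]; simp at hi; omega)
    obtain ⟨s⟩ := ih e.succ ⟨a, e, .y⟩ (by rw [Fin.val_succ]; simp at hi; omega)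
      (.inner e hp.le_index hr)
    exact ⟨.cons (Lifted.homMk (IsArrow.le h j _ _ _ ⟨hp, .inner e hp.le_index hr⟩)) s⟩

/-- The multimorphism that consists of the arrows of Hinich's diagram in the component of `j`. -/
noncomputable def universalMulti (h : a ≤ b) (j : Fin (σ.vertex b).len) :
    Multi (pairs (Lifted.mk.{u} (σ := σ)) a) (σ.arrow h j.castSucc) ⟨⟨b, j, .x⟩⟩
      (σ.arrow h j.succ) ⟨⟨b, j, .y⟩⟩ :=
  (nonempty_multi_of_source h j _ _ _
    (Nat.add_sub_of_le (Fin.le_def.1 (arrow_castSucc_le_succ h j))) .first).some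

variable (σ)

/-- The universal simplex over `σ`, in the operad of `F(σ)`: the unit of the adjunction. It is a
functor because `F(σ)` is an ordered set, so that there is at most one multimorphism with given
inputs and output. -/
noncomputable def universal : FunOver σ.functor (GHOperad.proj (Lifted.{u} σ)) where
  functor :=
    { obj a := ⟨σ.vertex a, pairs Lifted.mk a⟩
      map f := GHOperad.Hom.mk (σ.functor.map f) fun j => universalMulti (leOfHom f) j
      map_id a := GHOperad.hom_ext_of_isThin (σ.functor.map_id a)
      map_comp f g := GHOperad.hom_ext_of_isThin (σ.functor.map_comp f g) }
  w := rfl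

/-- The simplex over `σ` in the operad of `X` that corresponds to a functor `F(σ) ⥤ X`: the image
of the universal one. -/
noncomputable def realization (X : Type u) [Category.{v} X] :
    Core (hinichF.obj σ ⥤ X) ⥤ FunOver σ.functor (GHOperad.proj X) where
  obj Φ := (FunOver.postcomp σ.functor (GHOperad.map (Lifted.downFunctor.{u, v} σ ⋙ Φ.of))
    (GHOperad.map_comp_proj _)).obj (universal σ)
  map α := FunOver.postcompIso (GHOperad.map_comp_proj _) (GHOperad.map_comp_proj _)
    (GHOperad.mapIso (Functor.isoWhiskerLeft (Lifted.downFunctor.{u, v} σ) α.iso))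
    (GHOperad.mapIso_over _) (universal σ)
  map_id Φ := Subtype.ext (Iso.ext (NatTrans.ext (funext fun _ => rfl)))
  map_comp α β := by
    refine Subtype.ext (Iso.ext (NatTrans.ext (funext fun a => ?_)))
    exact (GHOperad.mapIsoHom_comp 
      (Functor.isoWhiskerLeft (Lifted.downFunctor.{u, v} σ) α.iso)
      (Functor.isoWhiskerLeft (Lifted.downFunctor.{u, v} σ) β.iso) _).symm

variable {σ} {X : Type u} [Category.{v} X]

/-- The members of the multimorphisms of the realization of `Φ` are the values of `Φ` at the arrows
of Hinich's diagram. -/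
lemma getElem?_arrows_realization (Φ : Core (hinichF.obj σ ⥤ X)) (h : a ≤ b)
    {j : Fin (σ.vertex b).len} {i : Fin ((σ.vertex a).len + 1)} {p q : F₀ σ}
    (hpq : σ.IsArrow h j i p q) :
    (GHOperad.Hom.multi (((realization σ X).obj Φ).functor.map (homOfLE h)) j).arrows[
      (i : ℕ) - σ.arrow h j.castSucc]? =
      some (Arrow.mk (Φ.of.map (homOfLE (IsArrow.le h j i p q hpq) : p ⟶ q))) := by
  obtain ⟨f, hf⟩ := exists_arrows_eq (universalMulti h j) hpq
  have key : ((universalMulti h j).map (Lifted.downFunctor σ ⋙ Φ.of)).arrows[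
      (i : ℕ) - σ.arrow h j.castSucc]? =
      some ((Lifted.downFunctor σ ⋙ Φ.of).mapArrow.obj (Arrow.mk f)) := by
    rw [Multi.arrows_map, List.getElem?_map, hf, Option.map_some]
  exact key

end AssSimplex

/-! ### Every simplex of the operad is a unique realization -/

lemma FunOver.ext_functor {A B E : Type*} [Category A] [Category B] [Category E]
    {σ : A ⥤ B} {π : E ⥤ B} {H K : FunOver σ π} (h : H.functor = K.functor) : H = K := by
  cases H
  cases K
  obtain rfl := h
  rfl

namespace AssSimplex

variable {σ : AssSimplex} {X : Type u} [Category.{v} X]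

/-- The label of each object and the value at each arrow of Hinich's graph can be read off from the
realization. -/
lemma realization_obj_injective : Function.Injective (realization σ X).obj := by
  intro Φ Ψ h
  have hF : ((realization σ X).obj Φ).functor = ((realization σ X).obj Ψ).functor :=
    congrArg FunOver.functor h
  -- edges are treated as natural numbers, so that the labels and the members at an edge become
  -- functions of a functor whose types do not depend on it
  refine congrArg Core.mk (functor_ext (fun p => ?_) fun p q hpq => ?_)
  · have := congrArg (fun F : Fin (σ.dim + 1) ⥤ GHOperad X =>
      if he : (p.edge : ℕ) < (F.obj p.level).base.len then
        some ((F.obj p.level).label ⟨p.edge, he⟩) else none) hF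
    have hlt : (p.edge : ℕ) < (((realization σ X).obj Φ).functor.obj p.level).base.len := p.edge.2
    have hlt' : (p.edge : ℕ) < (((realization σ X).obj Ψ).functor.obj p.level).base.len := p.edge.2
    rw [dif_pos hlt, dif_pos hlt', Option.some.injEq] at this
    obtain ⟨a, e, _ | _⟩ := p
    · exact congrArg Prod.fst this
    · exact congrArg Prod.snd this
  · obtain ⟨a, b, hab, j, i, hpq⟩ := hpq
    have hle : a ≤ b := Fin.le_def.2 (by omega)
    have := congrArg (fun F : Fin (σ.dim + 1) ⥤ GHOperad X =>
      if hj : (j : ℕ) < (F.obj b).base.len then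
        (GHOperad.Hom.multi (F.map (homOfLE hle)) ⟨j, hj⟩).arrows[
          (i : ℕ) - σ.arrow hle j.castSucc]? else none) hF
    have hlt : (j : ℕ) < (((realization σ X).obj Φ).functor.obj b).base.len := j.2
    have hlt' : (j : ℕ) < (((realization σ X).obj Ψ).functor.obj b).base.len := j.2
    rw [dif_pos hlt, dif_pos hlt'] at this
    exact Option.some_injective _ ((getElem?_arrows_realization Φ hle hpq).symm.trans
      (this.trans (getElem?_arrows_realization Ψ hle hpq)))

/-- A simplex of the operad labels the arrows of Hinich's graph by the members of the
multimorphisms of its edges `σ_a ⟶ σ_{a+1}`, and it is the realization of the resulting functor. -/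
lemma realization_obj_surjective : Function.Surjective (realization σ X).obj := by
  obtain ⟨k, S⟩ := σ
  rintro ⟨F, w⟩
  change Fin (k + 1) ⥤ GHOperad X at F
  change F ⋙ GHOperad.proj X = S at w
  subst w
  let σ : AssSimplex := ⟨k, F ⋙ GHOperad.proj X⟩
  let l : F₀ σ → X := fun p =>
    match p with
    | ⟨a, e, .x⟩ => ((F.obj a).label e).1
    | ⟨a, e, .y⟩ => ((F.obj a).label e).2
  let M {a b : Fin (k + 1)} (h : a ≤ b) (j : Fin (σ.vertex b).len) : Multi (pairs l a)
      (σ.arrow h j.castSucc) (l ⟨b, j, .x⟩) (σ.arrow h j.succ) (l ⟨b, j, .y⟩) :=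
    GHOperad.Hom.multi (F.map (homOfLE h)) j
  -- an arrow of the graph determines its position in the diagrams, so its label is well defined
  have hφ : ∀ p q : F₀ σ, σ.GraphArrow p q → ∃ f : l p ⟶ l q,
      ∀ (a b : Fin (k + 1)) (hab : (a : ℕ) + 1 = b) (j : Fin (σ.vertex b).len)
        (i : Fin ((σ.vertex a).len + 1)),
        σ.IsArrow (Fin.le_def.2 (by omega) : a ≤ b) j i p q →
        (M (Fin.le_def.2 (by omega) : a ≤ b) j).arrows[
          (i : ℕ) - σ.arrow (Fin.le_def.2 (by omega) : a ≤ b) j.castSucc]? =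
          some (Arrow.mk f) := by
    rintro p q ⟨a, b, hab, j, i, hpq⟩
    have hle : a ≤ b := Fin.le_def.2 (by omega)
    obtain ⟨f, hf⟩ := exists_arrows_eq (M hle j) hpq
    refine ⟨f, fun a' b' hab' j' i' hpq' => ?_⟩
    obtain ⟨rfl, rfl, hj, hi⟩ := hpq.2.index_unique hpq'.2 hab hab'
    obtain rfl := eq_of_heq hj
    obtain rfl := eq_of_heq hi
    exact hf
  choose φ hφ using hφ
  let Φ : Core (hinichF.obj σ ⥤ X) := ⟨liftGraph l φ⟩
  refine ⟨Φ, ?_⟩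
  have key : ((realization σ X).obj Φ).functor = F := by
    -- a functor on a finite ordinal is determined by its values on consecutive vertices
    refine ComposableArrows.ext (n := k) (fun a => rfl) fun a ha => ?_
    refine Eq.trans ?_ ((Category.id_comp _).trans (Category.comp_id _)).symm
    refine GHOperad.hom_ext_arrows rfl fun j => ?_
    have hle : (⟨a, by omega⟩ : Fin (k + 1)) ≤ ⟨a + 1, by omega⟩ := Fin.le_def.2 (by simp)
    refine arrows_eq_of_isArrow (σ := σ) (h := hle) (j := j)
      (Multi.length_arrows _) ?_ fun i p q hpq => ?_
    · exact (Multi.length_arrows _).trans (Multi.length_arrows _).symm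
    · refine (getElem?_arrows_realization Φ hle hpq).trans ?_
      have hg : σ.GraphArrow p q := ⟨_, _, rfl, j, i, hpq⟩
      have h1 := hφ p q hg _ _ rfl j i hpq
      refine Eq.trans ?_ h1.symm
      exact congrArg (fun f => some (Arrow.mk f)) (liftGraph_map l φ hg)
  exact FunOver.ext_functor key

end AssSimplex

/-! ### Isomorphisms of simplices of the operad -/

namespace GHOperad

variable {X : Type u} [Category.{v} X] {N : SimplexCategory} {t w z : Fin N.len → X × X}

/-- The morphism over an identity of `Ass` given by pairs of morphisms of `X`. -/
def homOfPairs (f : ∀ e, (w e).1 ⟶ (t e).1) (g : ∀ e, (t e).2 ⟶ (w e).2) :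
    (⟨N, t⟩ : GHOperad X) ⟶ ⟨N, w⟩ :=
  Hom.mk (𝟙 _) fun e => Multi.unary (f e) (g e)

lemma exists_eq_homOfPairs (h : (⟨N, t⟩ : GHOperad X) ⟶ ⟨N, w⟩) (hb : Hom.base h = 𝟙 _) :
    ∃ f g, h = homOfPairs f g := by
  obtain ⟨b, h⟩ := h
  obtain rfl : b = 𝟙 _ := hb
  choose f g hfg using fun e => Multi.exists_eq_unary (h e)
  exact ⟨f, g, Hom.ext rfl (heq_of_eq (funext hfg))⟩

lemma homOfPairs_inj {f f' : ∀ e, (w e).1 ⟶ (t e).1} {g g' : ∀ e, (t e).2 ⟶ (w e).2}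
    (h : (homOfPairs f g : (⟨N, t⟩ : GHOperad X) ⟶ ⟨N, w⟩) = homOfPairs f' g') :
    f = f' ∧ g = g' := by
  have := eq_of_heq (Hom.mk.inj h).2
  have h' := fun e => Multi.unary_inj.1 (congrFun this e)
  exact ⟨funext fun e => (h' e).1, funext fun e => (h' e).2⟩

lemma homOfPairs_comp (f : ∀ e, (w e).1 ⟶ (t e).1) (g : ∀ e, (t e).2 ⟶ (w e).2)
    (f' : ∀ e, (z e).1 ⟶ (w e).1) (g' : ∀ e, (w e).2 ⟶ (z e).2) :
    (homOfPairs f g : (⟨N, t⟩ : GHOperad X) ⟶ ⟨N, w⟩) ≫ homOfPairs f' g' =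
      homOfPairs (fun e => f' e ≫ f e) (fun e => g e ≫ g' e) :=
  Hom.ext (Category.id_comp _) (heq_of_eq rfl)

end GHOperad

namespace AssSimplex

variable {σ : AssSimplex} {X : Type u} [Category.{v} X]

instance : (realization σ X).Faithful where
  map_injective {Φ Ψ} α β h := by
    have key : ∀ a, _ := fun a => GHOperad.homOfPairs_inj (N := σ.vertex a)
      (t := pairs Φ.of.obj a) (w := pairs Ψ.of.obj a)
      (f := fun e => α.iso.inv.app (⟨a, e, .x⟩ : F₀ σ))
      (f' := fun e => β.iso.inv.app (⟨a, e, .x⟩ : F₀ σ))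
      (g := fun e => α.iso.hom.app (⟨a, e, .y⟩ : F₀ σ))
      (g' := fun e => β.iso.hom.app (⟨a, e, .y⟩ : F₀ σ))
      (congrArg (fun ε => ε.1.hom.app a) h)
    refine Core.hom_ext (NatTrans.ext (funext fun p => ?_))
    obtain ⟨a, e, _ | _⟩ := p
    · exact congrArg Iso.inv (Iso.ext (α := (α.iso.app (⟨a, e, .x⟩ : F₀ σ)).symm)
        (β := (β.iso.app (⟨a, e, .x⟩ : F₀ σ)).symm) (congrFun (key a).1 e))
    · exact congrFun (key a).2 e

/-- The components of a morphism over `Ass` lie over identities. -/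
lemma base_hom_app {Φ Ψ : Core (hinichF.obj σ ⥤ X)}
    (ε : (realization σ X).obj Φ ⟶ (realization σ X).obj Ψ) (a : Fin (σ.dim + 1)) :
    GHOperad.Hom.base (ε.1.hom.app a) = 𝟙 (op (σ.vertex a)) := by
  have h := congrArg (fun i => i.hom.app a) ε.2
  simp only [eqToIso.hom, eqToHom_app] at h
  exact h

/-- A morphism between realizations consists of pairs of morphisms of `X`. -/
lemma exists_hom_app_eq {Φ Ψ : Core (hinichF.obj σ ⥤ X)}
    (ε : (realization σ X).obj Φ ⟶ (realization σ X).obj Ψ) (a : Fin (σ.dim + 1)) :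
    ∃ (f : ∀ e, (pairs Ψ.of.obj a e).1 ⟶ (pairs Φ.of.obj a e).1)
      (g : ∀ e, (pairs Φ.of.obj a e).2 ⟶ (pairs Ψ.of.obj a e).2),
      ε.1.hom.app a = GHOperad.homOfPairs f g :=
  GHOperad.exists_eq_homOfPairs (N := σ.vertex a) (ε.1.hom.app a) (base_hom_app ε a)

lemma pairs_comp_eq_id {Φ Ψ : Core (hinichF.obj σ ⥤ X)}
    (ε : (realization σ X).obj Φ ⟶ (realization σ X).obj Ψ)
    (ε' : (realization σ X).obj Ψ ⟶ (realization σ X).obj Φ) (h : ε ≫ ε' = 𝟙 _)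
    {a : Fin (σ.dim + 1)} {f : ∀ e, (pairs Ψ.of.obj a e).1 ⟶ (pairs Φ.of.obj a e).1}
    {g : ∀ e, (pairs Φ.of.obj a e).2 ⟶ (pairs Ψ.of.obj a e).2}
    {f' : ∀ e, (pairs Φ.of.obj a e).1 ⟶ (pairs Ψ.of.obj a e).1}
    {g' : ∀ e, (pairs Ψ.of.obj a e).2 ⟶ (pairs Φ.of.obj a e).2}
    (hε : ε.1.hom.app a = GHOperad.homOfPairs f g)
    (hε' : ε'.1.hom.app a = GHOperad.homOfPairs f' g') (e : Fin (σ.vertex a).len) :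
    f' e ≫ f e = 𝟙 _ ∧ g e ≫ g' e = 𝟙 _ := by
  have h1 : ε.1.hom.app a ≫ ε'.1.hom.app a = 𝟙 _ := congrArg (fun ε => ε.1.hom.app a) h
  rw [hε, hε'] at h1
  have h2 := GHOperad.homOfPairs_inj ((GHOperad.homOfPairs_comp f g f' g').symm.trans
    (h1.trans (rfl : _ = GHOperad.homOfPairs (fun _ => 𝟙 _) (fun _ => 𝟙 _))))
  exact ⟨congrFun h2.1 e, congrFun h2.2 e⟩

/-- The pairs that constitute an isomorphism of realizations form a natural isomorphism; the first
component of a pair is inverted because it points from the target to the source. -/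
instance : (realization σ X).Full where
  map_surjective {Φ Ψ} ε := by
    choose f g hε using exists_hom_app_eq ε
    choose f' g' hε' using exists_hom_app_eq (Groupoid.inv ε)
    have h₁ := fun a => pairs_comp_eq_id _ _ (Groupoid.comp_inv ε) (hε a) (hε' a)
    have h₂ := fun a => pairs_comp_eq_id _ _ (Groupoid.inv_comp ε) (hε' a) (hε a)
    let α : ∀ p : F₀ σ, Φ.of.obj p ≅ Ψ.of.obj p := fun p =>
      match p with
      | ⟨a, e, .x⟩ => ⟨f' a e, f a e, (h₁ a e).1, (h₂ a e).1⟩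
      | ⟨a, e, .y⟩ => ⟨g a e, g' a e, (h₁ a e).2, (h₂ a e).2⟩
    have hα : ∀ (p q : F₀ σ) (h : σ.GraphArrow p q),
        Φ.of.map (homOfLE h.le : p ⟶ q) ≫ (α q).hom =
          (α p).hom ≫ Ψ.of.map (homOfLE h.le : p ⟶ q) := by
      rintro p q ⟨a, b, hab, j, i, hpq⟩
      have hle : a ≤ b := Fin.le_def.2 (by omega)
      have hnat := ε.1.hom.naturality (homOfLE hle)
      rw [hε a, hε b] at hnat
      -- the `j`-th multimorphism of the naturality square at `σ_a ⟶ σ_b`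
      have hj : ((((universalMulti hle j).map (Lifted.downFunctor σ ⋙ Φ.of)).append
            (.nil (α ⟨b, j, .y⟩).hom)).precomp (α ⟨b, j, .x⟩).inv) =
          ((universalMulti hle j).map (Lifted.downFunctor σ ⋙ Ψ.of)).subst
            (u := pairs Φ.of.obj a) (φ := id)
            (fun e => .unary (α ⟨a, e, .x⟩).inv (α ⟨a, e, .y⟩).hom) :=
        Multi.arrows_injective (congrArg
          (fun h : (⟨σ.vertex a, pairs Φ.of.obj a⟩ : GHOperad X) ⟶
            ⟨σ.vertex b, pairs Ψ.of.obj b⟩ => (GHOperad.Hom.multi h j).arrows) hnat)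
      have hj' := (Multi.precomp_hom_precomp_inv (α ⟨b, j, .x⟩) _).symm.trans
        (congrArg (Multi.precomp (α ⟨b, j, .x⟩).hom) hj)
      obtain ⟨m, hm⟩ := exists_arrows_eq (universalMulti hle j) hpq
      exact Multi.natural_of_subst_eq (G := Lifted.downFunctor σ ⋙ Φ.of)
        (G' := Lifted.downFunctor σ ⋙ Ψ.of) (fun c => α c.down) (universalMulti hle j)
        hj'.symm _ (List.mem_of_getElem? hm)
    refine ⟨⟨NatIso.ofComponents α fun {p q} m => natural_of_graphArrow
      (Φ := Φ.of) (Ψ := Ψ.of) (fun p => (α p).hom) hα m⟩, ?_⟩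
    refine Subtype.ext (Iso.ext (NatTrans.ext (funext fun a => ?_)))
    exact (hε a).symm

end AssSimplex

/-! ### Naturality of the realization -/

namespace FunOver

variable {A B E C : Type*} [Category A] [Category B] [Category E] [Category C]
  {σ : A ⥤ B} {π : E ⥤ B}

lemma eqToHom_hom {H K : FunOver σ π} (h : H = K) :
    (eqToHom h).1.hom = eqToHom (congrArg FunOver.functor h) := by
  subst h
  rfl

/-- Functors to a groupoid of functors over a base agree if they agree on objects and on the
components of the images of morphisms. -/
lemma functor_ext {P Q : C ⥤ FunOver σ π} (hobj : ∀ c, (P.obj c).functor = (Q.obj c).functor)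
    (hmap : ∀ c d (f : c ⟶ d) a, (P.map f).1.hom.app a =
      eqToHom (congrArg (fun F : A ⥤ E => F.obj a) (hobj c)) ≫ (Q.map f).1.hom.app a ≫
        eqToHom (congrArg (fun F : A ⥤ E => F.obj a) (hobj d).symm)) : P = Q := by
  refine CategoryTheory.Functor.ext (fun c => ext_functor (hobj c)) fun c d f => ?_
  refine Subtype.ext (Iso.ext (NatTrans.ext (funext fun a => ?_)))
  change _ = (eqToHom _ : P.obj c ⟶ Q.obj c).1.hom.app a ≫ (Q.map f).1.hom.app a ≫
    (eqToHom _ : Q.obj d ⟶ P.obj d).1.hom.app a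
  rw [eqToHom_hom, eqToHom_hom, eqToHom_app, eqToHom_app]
  exact hmap c d f a

lemma arrow_ext {H K H' K' : FunOver σ π} (e : H ⟶ K) (e' : H' ⟶ K')
    (hH : H.functor = H'.functor) (hK : K.functor = K'.functor)
    (h : ∀ a, e.1.hom.app a =
      eqToHom (congrArg (fun F : A ⥤ E => F.obj a) hH) ≫ e'.1.hom.app a ≫
        eqToHom (congrArg (fun F : A ⥤ E => F.obj a) hK.symm)) : Arrow.mk e = Arrow.mk e' := by
  obtain rfl := ext_functor hH
  obtain rfl := ext_functor hK
  refine congrArg Arrow.mk (Subtype.ext (Iso.ext (NatTrans.ext (funext fun a => ?_))))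
  simpa using h a

end FunOver

namespace AssSimplex

/-- Restriction of the universal simplex along `f : σ ⟶ τ`, which may be an inner face map. Both
sides have the same underlying monotone maps, which suffices in an ordered set. -/
lemma universal_naturality {σ τ : AssSimplex} (f : σ ⟶ τ) :
    f.toOrderHom.monotone.functor ⋙ (universal.{u, v} τ).functor =
      (universal.{u, v} σ).functor ⋙ GHOperad.map (Lifted.map f) := by
  obtain ⟨k, S⟩ := σ
  obtain ⟨f, w⟩ := f
  change Fin (k + 1) →o Fin (τ.dim + 1) at f
  change f.monotone.functor ⋙ τ.functor = S at w
  subst w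
  refine CategoryTheory.Functor.ext (fun a => rfl) fun a b g => ?_
  refine Eq.trans ?_ ((Category.id_comp _).trans (Category.comp_id _)).symm
  exact GHOperad.hom_ext_of_isThin rfl

lemma realization_naturality_left {σ τ : AssSimplex} (f : σ ⟶ τ) (X : Type u) [Category.{v} X] :
    realization τ X ⋙ FunOver.precomp f.toOrderHom.monotone.functor f.w (GHOperad.proj X) =
      ((Functor.whiskeringLeft _ _ X).obj (hinichF.map f).toFunctor).core ⋙ realization σ X := by
  obtain ⟨k, S⟩ := σ
  obtain ⟨f, w⟩ := f
  change Fin (k + 1) →o Fin (τ.dim + 1) at f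
  change f.monotone.functor ⋙ τ.functor = S at w
  subst w
  refine FunOver.functor_ext (fun Φ => ?_) fun _ _ _ _ => ?_
  · have h := universal_naturality.{v, u}
      (σ := ⟨k, f.monotone.functor ⋙ τ.functor⟩) (τ := τ) ⟨f, rfl⟩
    refine (congrArg (fun F : Fin (k + 1) ⥤ GHOperad (Lifted.{u} τ) =>
      F ⋙ GHOperad.map (Lifted.downFunctor.{u, v} τ ⋙ Φ.of)) h).trans ?_
    exact congrArg ((universal.{u, v} ⟨k, f.monotone.functor ⋙ τ.functor⟩).functor ⋙ ·)
      (GHOperad.map_comp_functor _ _)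
  · exact ((Category.id_comp _).trans (Category.comp_id _)).symm

lemma realization_naturality_right (σ : AssSimplex) {X Y : Type u} [Category.{v} X]
    [Category.{v} Y] (G : X ⥤ Y) :
    realization σ X ⋙
        FunOver.postcomp σ.functor (GHOperad.map G) (GHOperad.map_comp_proj G) =
      ((Functor.whiskeringRight _ _ _).obj G).core ⋙ realization σ Y :=
  FunOver.functor_ext
    (fun _ => congrArg ((universal.{u, v} σ).functor ⋙ ·) (GHOperad.map_comp_functor _ G))
    fun _ _ _ _ => ((Category.id_comp _).trans (Category.comp_id _)).symm

lemma realization_naturality_iso (σ : AssSimplex) {X Y : Type u} [Category.{v} X]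
    [Category.{v} Y] {G G' : X ⥤ Y} (α : G ≅ G') (Φ : Core (hinichF.obj σ ⥤ X)) :
    Arrow.mk (FunOver.postcompIso (GHOperad.map_comp_proj G) (GHOperad.map_comp_proj G')
      (GHOperad.mapIso α) (GHOperad.mapIso_over α) ((realization σ X).obj Φ)) =
    Arrow.mk ((realization σ Y).map (X := ⟨Φ.of ⋙ G⟩) (Y := ⟨Φ.of ⋙ G'⟩)
      (CoreHom.mk (Functor.isoWhiskerLeft Φ.of α))) :=
  FunOver.arrow_ext _ _
    (congrArg ((universal.{u, v} σ).functor ⋙ ·) (GHOperad.map_comp_functor _ G))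
    (congrArg ((universal.{u, v} σ).functor ⋙ ·) (GHOperad.map_comp_functor _ G'))
    fun _ => ((Category.id_comp _).trans (Category.comp_id _)).symm

end AssSimplex

/-! ### The inverse of the realization -/

namespace CategoryTheory.Functor

variable {C D : Type*} [Category C] [Category D] (R : C ⥤ D) (hR : Function.Bijective R.obj)
  [R.Full] [R.Faithful]

/-- The inverse of a fully faithful functor that is bijective on objects. -/
noncomputable def strictInverse : D ⥤ C where
  obj := (Equiv.ofBijective _ hR).symm
  map f := R.preimage (eqToHom (Equiv.ofBijective_apply_symm_apply _ hR _) ≫ f ≫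
    eqToHom (Equiv.ofBijective_apply_symm_apply _ hR _).symm)
  map_id _ := R.map_injective (by simp)
  map_comp _ _ := R.map_injective (by simp)

lemma strictInverse_comp : R.strictInverse hR ⋙ R = 𝟭 D :=
  CategoryTheory.Functor.ext (Equiv.ofBijective_apply_symm_apply _ hR)
    fun _ _ f => by simp [strictInverse]

lemma comp_strictInverse : R ⋙ R.strictInverse hR = 𝟭 C := by
  have hobj : ∀ c, (R ⋙ R.strictInverse hR).obj c = (𝟭 C).obj c :=
    Equiv.ofBijective_symm_apply_apply _ hR
  refine CategoryTheory.Functor.ext hobj fun _ _ f => R.map_injective ?_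
  rw [map_comp, map_comp, eqToHom_map, eqToHom_map]
  simp [strictInverse]

lemma strictInverse_obj_bijective : Function.Bijective (R.strictInverse hR).obj :=
  (Equiv.ofBijective _ hR).symm.bijective

lemma strictInverse_map_bijective (c d : D) :
    Function.Bijective (fun f : c ⟶ d => (R.strictInverse hR).map f) := by
  constructor
  · intro f g h
    have := congrArg R.map h
    simpa [strictInverse, cancel_epi, cancel_mono] using this
  · intro g
    refine ⟨eqToHom (Equiv.ofBijective_apply_symm_apply _ hR _).symm ≫ R.map g ≫
      eqToHom (Equiv.ofBijective_apply_symm_apply _ hR _), R.map_injective ?_⟩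
    simp [strictInverse]

lemma strictInverse_obj_obj (c : C) : (R.strictInverse hR).obj (R.obj c) = c :=
  Functor.congr_obj (R.comp_strictInverse hR) c

lemma arrow_mk_strictInverse_map {c d : C} (f : c ⟶ d) :
    Arrow.mk ((R.strictInverse hR).map (R.map f)) = Arrow.mk f :=
  congrArg (fun F : C ⥤ C => Arrow.mk (F.map f)) (R.comp_strictInverse hR)

/-- A square with two invertible sides yields the square of the inverses. -/
lemma comp_strictInverse_eq {C' D' : Type*} [Category C'] [Category D'] {R' : C' ⥤ D'}
    {hR' : Function.Bijective R'.obj} [R'.Full] [R'.Faithful] {P : D ⥤ D'} {Q : C ⥤ C'}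
    (h : R ⋙ P = Q ⋙ R') : P ⋙ R'.strictInverse hR' = R.strictInverse hR ⋙ Q := by
  calc P ⋙ R'.strictInverse hR'
      = (R.strictInverse hR ⋙ R) ⋙ P ⋙ R'.strictInverse hR' := by
        rw [strictInverse_comp]; rfl
    _ = R.strictInverse hR ⋙ (R ⋙ P) ⋙ R'.strictInverse hR' := rfl
    _ = R.strictInverse hR ⋙ Q ⋙ (R' ⋙ R'.strictInverse hR') := by rw [h]; rfl
    _ = R.strictInverse hR ⋙ Q := by rw [comp_strictInverse]; rfl

end CategoryTheory.Functor

/-! ### The formal adjunction -/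

namespace AssSimplex

lemma realization_obj_bijective (σ : AssSimplex) (X : Type u) [Category.{v} X] :
    Function.Bijective (realization σ X).obj :=
  ⟨realization_obj_injective, realization_obj_surjective⟩

/-- The comparison functor of the formal adjunction, as the inverse of the realization. -/
noncomputable def labelling (σ : AssSimplex) (X : Type u) [Category.{v} X] :
    FunOver σ.functor (GHOperad.proj X) ⥤ Core (hinichF.obj σ ⥤ X) :=
  (realization σ X).strictInverse (realization_obj_bijective σ X)

variable {σ : AssSimplex} {X : Type u} [Category.{v} X]

lemma labelling_realization (Φ : Core (hinichF.obj σ ⥤ X)) :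
    (labelling σ X).obj ((realization σ X).obj Φ) = Φ :=
  Functor.strictInverse_obj_obj _ _ Φ

lemma arrow_mk_labelling_map {Φ Ψ : Core (hinichF.obj σ ⥤ X)} (α : Φ ⟶ Ψ) :
    Arrow.mk ((labelling σ X).map ((realization σ X).map α)) = Arrow.mk α :=
  Functor.arrow_mk_strictInverse_map _ _ α

end AssSimplex

open AssSimplex in
/-- The formal adjunction given by the labelling of Hinich's diagrams. -/
noncomputable def labellingAdjunction : FormalAdjunction.{v, u} where
  adj σ X _ := labelling σ X
  bijective_obj _ _ _ := Functor.strictInverse_obj_bijective _ _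
  bijective_map _ _ _ _ _ := Functor.strictInverse_map_bijective _ _ _ _
  naturality_left f X _ := Functor.comp_strictInverse_eq _ _ (realization_naturality_left f X)
  naturality_right σ _ _ _ _ G :=
    Functor.comp_strictInverse_eq _ _ (realization_naturality_right σ G)
  naturality_iso σ X Y _ _ G G' α H := by
    obtain ⟨Φ, rfl⟩ := realization_obj_surjective H
    rw [labelling_realization]
    exact (congrArg (labelling σ Y).mapArrow.obj (realization_naturality_iso σ α Φ)).trans
      (arrow_mk_labelling_map _)

open AssSimplex in
lemma isLabelling_labellingAdjunction : labellingAdjunction.{v, u}.IsLabelling where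
  obj_x σ X _ H a e := by
    obtain ⟨Φ, rfl⟩ := realization_obj_surjective H
    exact congrArg (fun Ψ : Core (hinichF.obj σ ⥤ X) => Ψ.of.obj (⟨a, e, .x⟩ : F₀ σ))
      (labelling_realization Φ)
  obj_y σ X _ H a e := by
    obtain ⟨Φ, rfl⟩ := realization_obj_surjective H
    exact congrArg (fun Ψ : Core (hinichF.obj σ ⥤ X) => Ψ.of.obj (⟨a, e, .y⟩ : F₀ σ))
      (labelling_realization Φ)
  map σ X _ H a b h j i p q hpq := by
    obtain ⟨Φ, rfl⟩ := realization_obj_surjective H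
    refine (getElem?_arrows_realization Φ h hpq).trans ?_
    exact congrArg (fun Ψ : Core (hinichF.obj σ ⥤ X) => some (Arrow.mk (Ψ.of.map
      (homOfLE (IsArrow.le h j i p q hpq) : p ⟶ q)))) (labelling_realization Φ).symm
  iso σ X _ H K ε a e := by
    obtain ⟨Φ, rfl⟩ := realization_obj_surjective H
    obtain ⟨Ψ, rfl⟩ := realization_obj_surjective K
    obtain ⟨α, rfl⟩ := (realization σ X).map_surjective ε
    exact congrArg (fun α : Arrow (Core (hinichF.obj σ ⥤ X)) =>
      [Arrow.mk (α.hom.iso.inv.app (⟨a, e, .x⟩ : F₀ σ)),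
        Arrow.mk (α.hom.iso.hom.app (⟨a, e, .y⟩ : F₀ σ))]) (arrow_mk_labelling_map α).symm

theorem mainTheorem2 : ∃ A : FormalAdjunction.{v, u}, A.IsLabelling := by
  exact ⟨labellingAdjunction, isLabelling_labellingAdjunction⟩
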